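/- Let $\alpha,\beta>0$. On $L^2(\mathbb R)$ (complex-valued functions) let $\mathcal F f(\xi)=\int_{\mathbb R} f(x)e^{-i\xi x}\,dx$ and $\mathcal F^{-1}g(x)=\frac1{2\pi}\int_{\mathbb R} g(\xi)e^{ix\xi}\,d\xi$ denote the Fourier transform and its inverse, let $m_S(x)=e^{-\alpha x^2/2}$ and $\widehat{m_F}(\xi)=e^{-\beta\xi^2/2}$, and define the bounded operators $\mathcal M_Sf=m_Sf$, $\mathcal M_Ff=\mathcal F^{-1}[\widehat{m_F}\,\mathcal F f]$ and $\mathcal K=\mathcal M_S^*\mathcal M_F^*\mathcal M_F\mathcal M_S$. Then $$\mathcal K=e^{-\frac12\alpha x^2}\,e^{\beta\Delta}\,e^{-\frac12\alpha x^2}=\exp\!\Big(-\operatorname{arsinh}(\sqrt{\alpha\beta})\Big[\sqrt{\tfrac{\alpha(1+\alpha\beta)}{\beta}}\;x^2-\sqrt{\tfrac{\beta}{\alpha(1+\alpha\beta)}}\;\Delta\Big]\Big).$$ Here $e^{-\frac12\alpha x^2}$ is the multiplication operator, $\Delta=d^2/dx^2$, and for an unbounded operator $A$, $e^{A}$ is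 the value at time $1$ of the strongly continuous semigroup generated by $A$; the differential operators $\beta\Delta$ and $-\operatorname{arsinh}(\sqrt{\alpha\beta})[\cdots]$ have their maximal domains in $L^2(\mathbb R)$, that is, all $f\in L^2(\mathbb R)$ that the operator, applied in the sense of tempered distributions, maps into $L^2(\mathbb R)$, and it is part of the claim that they generate such semigroups. Moreover, the eigenpairs of $\mathcal K$ are given by $$\psi_n(x)=\Big(\tfrac{\alpha(1+\alpha\beta)}{\beta}\Big)^{1/8}\varphi_n\Big(\Big(\tfrac{\alpha(1+\alpha\beta)}{\beta}\Big)^{1/4}x\Big),\qquad \lambda_n=e^{-\operatorname{arsinh}(\sqrt{\alpha\beta})(2n+1)},\qquad n=0,1,2,\dots,$$ where $\varphi_n(x)=(2^n n!\sqrt\pi)^{-1/2}H_n(x)e^{-x^2/2}$ are the normalized Hermite functions, with $H_n(x)=(-1)^n e^{x^2}\frac{d^n}{dx^n}e^{-x^2}$. That is, $(\psi_n)_{n\ge0}$ is an orthonormal family with dense linear span in $L^2(\mathbb R)$, and for $\lambda\in\mathbb C$ and $f\in L^2(\mathbb R)$ one has $f\neq0$ and $\mathcal Kf=\lambda f$ if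 and only if $\lambda=\lambda_n$ and $f=c\,\psi_n$ for some $n\ge0$ and some $c\in\mathbb C\setminus\{0\}$. -/

import Mathlib

open MeasureTheory Filter Topology
open scoped ENNReal NNReal FourierTransform SchwartzMap Laplacian

/-- The complex Hilbert space `L²(ℝ)`. -/
abbrev L2R : Type := Lp ℂ 2 (volume : Measure ℝ)

/-! ### Dilations and the Fourier transform in angular frequency -/

theorem quasiMeasurePreserving_dilation {c : ℝ} (hc : c ≠ 0) :
    Measure.QuasiMeasurePreserving (fun x : ℝ => c * x) volume volume := by
  refine ⟨measurable_const_mul c, ?_⟩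
  rw [Real.map_volume_mul_left hc]
  exact Measure.smul_absolutelyContinuous

theorem eLpNorm_dilation {c : ℝ} (hc : c ≠ 0) {f : ℝ → ℂ} (hf : AEStronglyMeasurable f volume) :
    eLpNorm (fun x => f (c * x)) 2 volume
      = ENNReal.ofReal (|c⁻¹| ^ (1 / 2 : ℝ)) * eLpNorm f 2 volume := by
  have hac : Measure.map (fun x : ℝ => c * x) volume ≪ volume :=
    (quasiMeasurePreserving_dilation hc).absolutelyContinuous
  have h := eLpNorm_map_measure (p := 2) (hf.mono_ac hac)
    (measurable_const_mul c).aemeasurable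
  have h2 : (f ∘ fun x : ℝ => c * x) = fun x => f (c * x) := rfl
  rw [h2] at h
  rw [← h, Real.map_volume_mul_left hc, eLpNorm_smul_measure_of_ne_top (by simp)]
  rw [ENNReal.ofReal_rpow_of_nonneg (abs_nonneg _) (by norm_num)]
  simp

theorem memLp_dilation {c : ℝ} (hc : c ≠ 0) (f : L2R) :
    MemLp (fun x => f (c * x)) 2 (volume : Measure ℝ) := by
  refine ⟨(Lp.aestronglyMeasurable f).comp_quasiMeasurePreserving
    (quasiMeasurePreserving_dilation hc), ?_⟩
  rw [eLpNorm_dilation hc (Lp.aestronglyMeasurable f)]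
  exact ENNReal.mul_lt_top ENNReal.ofReal_lt_top (Lp.memLp f).2

/-- The dilation `f ↦ f(c ·)` on `L²(ℝ)`, for `c ≠ 0`. -/
noncomputable def dilation (c : ℝ) (hc : c ≠ 0) : L2R →L[ℂ] L2R :=
  LinearMap.mkContinuous
    { toFun := fun f => (memLp_dilation hc f).toLp _
      map_add' := fun f g => by
        rw [← MemLp.toLp_add]
        apply MemLp.toLp_congr
        exact (quasiMeasurePreserving_dilation hc).ae_eq_comp (Lp.coeFn_add f g)
      map_smul' := fun a f => by
        rw [RingHom.id_apply, ← MemLp.toLp_const_smul]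
        apply MemLp.toLp_congr
        exact (quasiMeasurePreserving_dilation hc).ae_eq_comp (Lp.coeFn_smul a f) }
    (|c⁻¹| ^ (1 / 2 : ℝ))
    (fun f => by
      change ‖(memLp_dilation hc f).toLp _‖ ≤ _
      rw [Lp.norm_toLp, eLpNorm_dilation hc (Lp.aestronglyMeasurable f), ENNReal.toReal_mul,
        ENNReal.toReal_ofReal (by positivity), Lp.norm_def])

/-- The Fourier transform `(ℱ f)(ξ) = ∫ f(x) e^{-iξx} dx` on `L²(ℝ)`. The Fourier transform `𝓕`
of Mathlib has the phase `e^{-2πiηx}`, so that `(ℱ f)(ξ) = (𝓕 f)(ξ / (2π))`. -/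
noncomputable def angularFourier : L2R →L[ℂ] L2R :=
  dilation (2 * Real.pi)⁻¹ (inv_ne_zero Real.two_pi_pos.ne') ∘L
    (Lp.fourierTransformₗᵢ ℝ ℂ).toContinuousLinearEquiv.toContinuousLinearMap

/-- The inverse transform `(ℱ⁻¹ g)(x) = (2π)⁻¹ ∫ g(ξ) e^{iξx} dξ` on `L²(ℝ)`; substituting
`ξ = 2πη`, it is Mathlib's inverse Fourier transform of `η ↦ g(2πη)`. -/
noncomputable def angularFourierInv : L2R →L[ℂ] L2R :=
  (Lp.fourierTransformₗᵢ ℝ ℂ).symm.toContinuousLinearEquiv.toContinuousLinearMap ∘L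
    dilation (2 * Real.pi) Real.two_pi_pos.ne'

/-! ### The concentration operator -/

/-- Multiplication by a bounded mask `m`, as a bounded operator of `L²(ℝ)`. -/
noncomputable def spaceFilter (m : Lp ℂ ∞ (volume : Measure ℝ)) : L2R →L[ℂ] L2R :=
  (ContinuousLinearMap.mul ℂ ℂ).holderL volume ∞ 2 2 m

/-- The Fourier filter `f ↦ ℱ⁻¹[m · ℱ f]` with bounded mask `m`. -/
noncomputable def fourierFilter (m : Lp ℂ ∞ (volume : Measure ℝ)) : L2R →L[ℂ] L2R :=
  angularFourierInv ∘L spaceFilter m ∘L angularFourier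

/-- The concentration operator `M_S^* M_F^* M_F M_S` of a space mask and a Fourier mask. -/
noncomputable def concentrationOp (mS mF : Lp ℂ ∞ (volume : Measure ℝ)) : L2R →L[ℂ] L2R :=
  (spaceFilter mS).adjoint ∘L (fourierFilter mF).adjoint ∘L fourierFilter mF ∘L spaceFilter mS

/-! ### Unbounded operators and their exponentials -/

theorem injective_toTemperedDistribution :
    Function.Injective
      ((Lp.toTemperedDistributionCLM ℂ (volume : Measure ℝ) 2).toLinearMap :
        L2R →ₗ[ℂ] 𝓢'(ℝ, ℂ)) :=
  LinearMap.ker_eq_bot.mp Lp.ker_toTemperedDistributionCLM_eq_bot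

/-- The realization in `L²(ℝ)`, with maximal domain, of an operator `D` on tempered distributions:
the domain consists of the `f ∈ L²(ℝ)` for which the distribution `D f` belongs to `L²(ℝ)`, and
`f` is mapped to `D f`. -/
noncomputable def maximalRealization (D : 𝓢'(ℝ, ℂ) →L[ℂ] 𝓢'(ℝ, ℂ)) : L2R →ₗ.[ℂ] L2R where
  domain := Submodule.comap
    (D.toLinearMap ∘ₗ (Lp.toTemperedDistributionCLM ℂ (volume : Measure ℝ) 2).toLinearMap)
    (LinearMap.range (Lp.toTemperedDistributionCLM ℂ (volume : Measure ℝ) 2).toLinearMap)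
  toFun :=
    (LinearEquiv.ofInjective _ injective_toTemperedDistribution).symm.toLinearMap ∘ₗ
      LinearMap.restrict
        (D.toLinearMap ∘ₗ (Lp.toTemperedDistributionCLM ℂ (volume : Measure ℝ) 2).toLinearMap)
        (fun _ hf => hf)

theorem mem_graph_maximalRealization (D : 𝓢'(ℝ, ℂ) →L[ℂ] 𝓢'(ℝ, ℂ)) (f g : L2R) :
    (f, g) ∈ (maximalRealization D).graph ↔ (g : 𝓢'(ℝ, ℂ)) = D (f : 𝓢'(ℝ, ℂ)) := by
  rw [LinearPMap.mem_graph_iff]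
  constructor
  · rintro ⟨y, hy, hg⟩
    have h := LinearEquiv.apply_symm_apply
      (LinearEquiv.ofInjective _ injective_toTemperedDistribution)
      (LinearMap.restrict
        (D.toLinearMap ∘ₗ (Lp.toTemperedDistributionCLM ℂ (volume : Measure ℝ) 2).toLinearMap)
        (fun _ hf => hf) y)
    have h' := congrArg Subtype.val h
    simp only at hy hg
    subst hy
    rw [← hg]
    exact h'
  · intro h
    refine ⟨⟨f, ⟨g, h⟩⟩, rfl, ?_⟩
    apply (LinearEquiv.ofInjective _ injective_toTemperedDistribution).injective
    refine (LinearEquiv.apply_symm_apply _ _).trans ?_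
    exact Subtype.ext h.symm

/-- The Laplacian `Δ = d²/dx²` on `L²(ℝ)`. -/
noncomputable def laplacianL2 : L2R →ₗ.[ℂ] L2R :=
  maximalRealization (LineDeriv.laplacianCLM ℂ ℝ 𝓢'(ℝ, ℂ))

/-- The harmonic oscillator `a x² - b Δ` on `L²(ℝ)`. -/
noncomputable def harmonicOscillator (a b : ℝ) : L2R →ₗ.[ℂ] L2R :=
  maximalRealization
    ((a : ℂ) • TemperedDistribution.smulLeftCLM ℂ (fun x : ℝ => (x : ℂ) ^ 2)
      - (b : ℂ) • LineDeriv.laplacianCLM ℂ ℝ 𝓢'(ℝ, ℂ))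

/-- A strongly continuous one-parameter semigroup of bounded operators on `X`. -/
structure C0Semigroup (X : Type*) [NormedAddCommGroup X] [NormedSpace ℂ X] where
  op : ℝ≥0 → X →L[ℂ] X
  op_zero : op 0 = ContinuousLinearMap.id ℂ X
  op_add : ∀ s t, op (s + t) = op s ∘L op t
  tendsto_zero : ∀ f, Tendsto (fun t => op t f) (𝓝 0) (𝓝 f)

/-- `A` is the generator of the semigroup `S`: `f` is in the domain of `A` and `A f = g` if and
only if `(S(t) f - f) / t` tends to `g` as `t → 0⁺`. -/
def C0Semigroup.HasGenerator {X : Type*} [NormedAddCommGroup X] [NormedSpace ℂ X]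
    (S : C0Semigroup X) (A : X →ₗ.[ℂ] X) : Prop :=
  ∀ f g : X, (f, g) ∈ A.graph ↔
    Tendsto (fun t : ℝ≥0 => ((t : ℝ)⁻¹ : ℂ) • (S.op t f - f)) (𝓝[>] 0) (𝓝 g)

/-- `T = e^A`: the operator `A` generates a strongly continuous semigroup `(e^{tA})_{t ≥ 0}`
(which is unique) and `T` is its value at time `1`. -/
def IsOperatorExp {X : Type*} [NormedAddCommGroup X] [NormedSpace ℂ X]
    (A : X →ₗ.[ℂ] X) (T : X →L[ℂ] X) : Prop :=
  ∃ S : C0Semigroup X, S.HasGenerator A ∧ S.op 1 = T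

/-! ### Hermite functions -/

/-- The normalized Hermite functions `φ_n(x) = (2ⁿ n! √π)^{-1/2} H_n(x) e^{-x²/2}`. Mathlib's
`Polynomial.hermite` is the probabilists' polynomial `He_n`, and `H_n(x) = 2^{n/2} He_n(√2 x)`. -/
noncomputable def hermiteFunction (n : ℕ) (x : ℝ) : ℝ :=
  Polynomial.aeval (Real.sqrt 2 * x) (Polynomial.hermite n) * Real.exp (-x ^ 2 / 2)
    / Real.sqrt (n.factorial * Real.sqrt Real.pi)

/-! Put ω = √(α(1+αβ)/β), so that β(ω² − α²) = α, and τ = arsinh √(αβ). Both 𝒦 and the exponential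
of the oscillator are diagonal in one orthonormal basis, the Hermite functions ψ_n dilated to the
Gaussian e^{-ωx²/2}, with the same eigenvalues e^{-τ(2n+1)}.

For 𝒦: the masks are real, so 𝒦 = M_S e^{βΔ} M_S. Up to a constant, ψ_n is H e^{-ωx²/2} with H(x) =
He_n(√(2ω) x). The first M_S turns ω into ω + α. The heat operator sends the result to q^{n+1/2} H
e^{-(ω-α)x²/2} with the same H and q = (ω−α)/(ω+α) = e^{-2τ}; the relation β(ω² − α²) = α says that
the heat flow joins these two Gaussian widths (`exp_mul_fourier_polyGaussian`). The second M_S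
restores ω (`concentrationOp_hermiteBasis`).

For the exponential: ωx² − ω⁻¹Δ multiplies ψ_n by 2n+1, and its maximal realization acts
coefficientwise in this basis (`mem_graph_harmonicOscillator_iff_inner`). It is thus unitarily
equivalent to a multiplication operator on L² of the counting measure. Multiplication by −m, m ≥ 0,
with maximal domain generates e^{-tm} by dominated convergence (`tendsto_mulSemigroup_iff`); through
the Fourier transform the same fact gives e^{βΔ}.

Completeness of the ψ_n is a moment argument (`eq_zero_of_forall_integral_polyGaussian`). The
eigenpairs follow because the eigenvalues are distinct. -/

/-! ### Multiplication semigroups -/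

/-- Dominated convergence in `L²`. -/
theorem tendsto_Lp_two_of_dominated {X ι : Type*} [MeasurableSpace X] {μ : Measure X}
    {l : Filter ι} [l.IsCountablyGenerated] {u : ι → Lp ℂ 2 μ} {v w : Lp ℂ 2 μ}
    (hb : ∀ᶠ i in l, ∀ᵐ x ∂μ, ‖u i x‖ ≤ ‖w x‖)
    (hlim : ∀ k : ℕ → ι, Tendsto k atTop l →
      ∀ᵐ x ∂μ, Tendsto (fun i => u (k i) x) atTop (𝓝 (v x))) :
    Tendsto u l (𝓝 v) := by
  -- Sequences suffice for a countably generated filter, and along a sequence only countably many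
  -- null sets have to be discarded.
  refine tendsto_of_seq_tendsto fun k hk => ?_
  rw [Lp.tendsto_Lp_iff_tendsto_eLpNorm']
  have h2 : ∀ f : X → ℂ, eLpNorm f 2 μ = (∫⁻ x, ‖f x‖ₑ ^ (2 : ℝ) ∂μ) ^ (1 / 2 : ℝ) := fun f => by
    rw [eLpNorm_eq_lintegral_rpow_enorm_toReal (by norm_num) (by norm_num)]
    norm_num
  simp only [h2]
  have hw : ∫⁻ x, (2 * ‖w x‖ₑ) ^ (2 : ℝ) ∂μ ≠ ∞ := by
    have h := (Lp.memLp w).2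
    rw [h2] at h
    have h' := (ENNReal.rpow_lt_top_iff_of_pos (by norm_num)).1 h
    simp_rw [ENNReal.mul_rpow_of_nonneg _ _ (zero_le_two : (0 : ℝ) ≤ 2)]
    rw [lintegral_const_mul' _ _ (by norm_num)]
    exact ENNReal.mul_ne_top (by norm_num) h'.ne
  have hbk := hk.eventually hb
  have hvw : ∀ᵐ x ∂μ, ‖v x‖ ≤ ‖w x‖ := by
    obtain ⟨N, hN⟩ := eventually_atTop.1 hbk
    have hall : ∀ᵐ x ∂μ, ∀ n, N ≤ n → ‖u (k n) x‖ ≤ ‖w x‖ := by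
      rw [ae_all_iff]
      intro n
      by_cases hn : N ≤ n
      · filter_upwards [hN n hn] with x hx _ using hx
      · exact Eventually.of_forall fun x h => absurd h hn
    filter_upwards [hall, hlim k hk] with x hx hx'
    exact le_of_tendsto hx'.norm (eventually_atTop.2 ⟨N, hx⟩)
  have hint : Tendsto (fun i => ∫⁻ x, ‖(⇑(u (k i)) - ⇑v) x‖ₑ ^ (2 : ℝ) ∂μ) atTop
      (𝓝 (∫⁻ _, 0 ∂μ)) := by
    refine tendsto_lintegral_filter_of_dominated_convergence'
      (fun x => (2 * ‖w x‖ₑ) ^ (2 : ℝ)) (Eventually.of_forall fun i => ?_) ?_ hw ?_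
    · exact (((Lp.aestronglyMeasurable _).sub (Lp.aestronglyMeasurable _)).enorm).pow_const _
    · filter_upwards [hbk] with i hi
      filter_upwards [hi, hvw] with x hx hx'
      refine ENNReal.rpow_le_rpow ?_ zero_le_two
      rw [Pi.sub_apply, two_mul]
      refine (enorm_sub_le).trans (add_le_add ?_ ?_)
      · exact enorm_le_iff_norm_le.2 hx
      · exact enorm_le_iff_norm_le.2 hx'
    · filter_upwards [hlim k hk] with x hx
      have h0 : Tendsto (fun i => u (k i) x - v x) atTop (𝓝 0) := by
        simpa using hx.sub_const (v x)
      have h1 : Tendsto (fun i => ‖u (k i) x - v x‖ₑ ^ (2 : ℝ)) atTop (𝓝 (‖(0 : ℂ)‖ₑ ^ (2 : ℝ))) :=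
        h0.enorm.ennrpow_const _
      simpa using h1
  rw [lintegral_zero] at hint
  simpa using hint.ennrpow_const (1 / 2 : ℝ)

section

variable {X : Type*} [MeasurableSpace X] {μ : Measure X}

theorem memLp_top_exp_neg_mul {m : X → ℝ} (hm : Measurable m) (h0 : ∀ x, 0 ≤ m x) (t : ℝ≥0) :
    MemLp (fun x => ((Real.exp (-(t * m x)) : ℝ) : ℂ)) ∞ μ := by
  refine memLp_top_of_bound (C := 1) ?_ ?_
  · exact (Complex.measurable_ofReal.comp
      (Real.measurable_exp.comp (hm.const_mul _).neg)).aestronglyMeasurable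
  · refine Eventually.of_forall fun x => ?_
    rw [Complex.norm_real, Real.norm_of_nonneg (Real.exp_pos _).le]
    exact Real.exp_le_one_iff.2 (neg_nonpos.2 (mul_nonneg t.2 (h0 x)))

/-- Multiplication by `exp (-t m)` on `L²(μ)`, for a nonnegative measurable function `m`. -/
noncomputable def expMul (m : X → ℝ) (hm : Measurable m) (h0 : ∀ x, 0 ≤ m x) (t : ℝ≥0) :
    Lp ℂ 2 μ →L[ℂ] Lp ℂ 2 μ :=
  (ContinuousLinearMap.mul ℂ ℂ).holderL μ ∞ 2 2 ((memLp_top_exp_neg_mul hm h0 t).toLp _)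

variable {m : X → ℝ} {hm : Measurable m} {h0 : ∀ x, 0 ≤ m x}

theorem coeFn_expMul (t : ℝ≥0) (f : Lp ℂ 2 μ) :
    expMul m hm h0 t f =ᵐ[μ] fun x => ((Real.exp (-(t * m x)) : ℝ) : ℂ) * f x := by
  have h := (ContinuousLinearMap.mul ℂ ℂ).coeFn_holder (r := 2)
    ((memLp_top_exp_neg_mul (μ := μ) hm h0 t).toLp _) f
  refine h.trans ?_
  filter_upwards [(memLp_top_exp_neg_mul (μ := μ) hm h0 t).coeFn_toLp] with x hx
  rw [hx]
  rfl

theorem tendsto_expMul_apply (f : Lp ℂ 2 μ) :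
    Tendsto (fun t => expMul m hm h0 t f) (𝓝 0) (𝓝 f) := by
  refine tendsto_Lp_two_of_dominated (w := f) (Eventually.of_forall fun t => ?_) fun k hk => ?_
  · filter_upwards [coeFn_expMul (hm := hm) (h0 := h0) t f] with x hx
    rw [hx, norm_mul, Complex.norm_real, Real.norm_of_nonneg (Real.exp_pos _).le]
    exact mul_le_of_le_one_left (norm_nonneg _)
      (Real.exp_le_one_iff.2 (neg_nonpos.2 (mul_nonneg t.2 (h0 x))))
  · have hall : ∀ᵐ x ∂μ, ∀ i, expMul m hm h0 (k i) f x
        = ((Real.exp (-((k i : ℝ≥0) * m x)) : ℝ) : ℂ) * f x :=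
      ae_all_iff.2 fun i => coeFn_expMul (k i) f
    filter_upwards [hall] with x hx
    simp_rw [hx]
    have hc : Continuous fun t : ℝ≥0 => ((Real.exp (-((t : ℝ) * m x)) : ℝ) : ℂ) * f x := by
      fun_prop
    have := (hc.tendsto 0).comp hk
    simpa [Function.comp_def] using this

/-- The semigroup of the multiplication operators `exp (-t m)`, transported by a unitary map. -/
noncomputable def mulSemigroup {H : Type*} [NormedAddCommGroup H] [InnerProductSpace ℂ H]
    (U : H ≃ₗᵢ[ℂ] Lp ℂ 2 μ) (m : X → ℝ) (hm : Measurable m) (h0 : ∀ x, 0 ≤ m x) :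
    C0Semigroup H where
  op t := U.symm.toContinuousLinearEquiv.toContinuousLinearMap ∘L expMul m hm h0 t ∘L
    U.toContinuousLinearEquiv.toContinuousLinearMap
  op_zero := by
    ext f
    apply U.injective
    change U (U.symm (expMul m hm h0 0 (U f))) = U f
    rw [U.apply_symm_apply]
    apply Lp.ext
    filter_upwards [coeFn_expMul (hm := hm) (h0 := h0) 0 (U f)] with x hx
    simp [hx]
  op_add s t := by
    ext f
    apply U.injective
    change U (U.symm (expMul m hm h0 (s + t) (U f)))
      = U (U.symm (expMul m hm h0 s (U (U.symm (expMul m hm h0 t (U f))))))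
    rw [U.apply_symm_apply, U.apply_symm_apply, U.apply_symm_apply]
    apply Lp.ext
    filter_upwards [coeFn_expMul (hm := hm) (h0 := h0) (s + t) (U f),
      coeFn_expMul (hm := hm) (h0 := h0) t (U f),
      coeFn_expMul (hm := hm) (h0 := h0) s (expMul m hm h0 t (U f))] with x h1 h2 h3
    rw [h1, h3, h2, ← mul_assoc, ← Complex.ofReal_mul, ← Real.exp_add]
    congr 4
    push_cast
    ring
  tendsto_zero f := by
    have h := (U.symm.continuous.tendsto _).comp
      (tendsto_expMul_apply (hm := hm) (h0 := h0) (U f))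
    rw [U.symm_apply_apply] at h
    exact h

theorem tendsto_exp_neg_mul_sub_one_div (a : ℝ) :
    Tendsto (fun t : ℝ => t⁻¹ * (Real.exp (-(t * a)) - 1)) (𝓝[≠] 0) (𝓝 (-a)) := by
  have h : HasDerivAt (fun t : ℝ => Real.exp (-(t * a))) (-a) 0 := by
    have h1 : HasDerivAt (fun t : ℝ => -(t * a)) (-(1 * a)) 0 :=
      ((hasDerivAt_id (0 : ℝ)).mul_const a).neg
    simpa using h1.exp
  rw [hasDerivAt_iff_tendsto_slope_zero] at h
  simpa using h

theorem tendsto_coe_nhdsGT_zero :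
    Tendsto (fun t : ℝ≥0 => (t : ℝ)) (𝓝[>] 0) (𝓝[≠] 0) := by
  refine tendsto_nhdsWithin_iff.2 ⟨?_, ?_⟩
  · exact (NNReal.continuous_coe.tendsto' 0 0 rfl).mono_left nhdsWithin_le_nhds
  · filter_upwards [self_mem_nhdsWithin] with t ht
    exact (NNReal.coe_pos.2 ht).ne'

/-- From 1 − ta ≤ e^{-ta} ≤ 1. The bound is uniform in t, which lets it dominate the difference
quotients of the semigroup. -/
theorem abs_exp_neg_mul_sub_one_div_le {t a : ℝ} (ht : 0 < t) (ha : 0 ≤ a) :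
    |t⁻¹ * (Real.exp (-(t * a)) - 1)| ≤ a := by
  have h1 := Real.add_one_le_exp (-(t * a))
  have h2 : Real.exp (-(t * a)) ≤ 1 := Real.exp_le_one_iff.2 (neg_nonpos.2 (by positivity))
  rw [abs_mul, abs_of_pos (inv_pos.2 ht), abs_of_nonpos (by linarith), inv_mul_le_iff₀ ht]
  linarith

/-- The difference quotients always converge pointwise to −m·Uf. An L² limit is an a.e. limit along
some sequence, so it must be this function. Conversely, if −m·Uf is the L² function Ug, then |Ug|
dominates the quotients. -/
theorem tendsto_mulSemigroup_iff {H : Type*} [NormedAddCommGroup H] [InnerProductSpace ℂ H]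
    (U : H ≃ₗᵢ[ℂ] Lp ℂ 2 μ) (f g : H) :
    Tendsto (fun t : ℝ≥0 => ((t : ℝ)⁻¹ : ℂ) • ((mulSemigroup U m hm h0).op t f - f))
      (𝓝[>] 0) (𝓝 g) ↔ U g =ᵐ[μ] fun x => -(m x : ℂ) * U f x := by
  set u : ℝ≥0 → Lp ℂ 2 μ :=
    fun t => ((t : ℝ)⁻¹ : ℂ) • (expMul m hm h0 t (U f) - U f) with hu
  have hU : ∀ t : ℝ≥0, U (((t : ℝ)⁻¹ : ℂ) • ((mulSemigroup U m hm h0).op t f - f)) = u t := by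
    intro t
    rw [map_smul, map_sub]
    change _ • (U (U.symm (expMul m hm h0 t (U f))) - U f) = _
    rw [U.apply_symm_apply]
  have hcoe : ∀ t : ℝ≥0, u t =ᵐ[μ] fun x =>
      (((t : ℝ)⁻¹ * (Real.exp (-(t * m x)) - 1) : ℝ) : ℂ) * U f x := by
    intro t
    filter_upwards [Lp.coeFn_smul ((t : ℝ)⁻¹ : ℂ) (expMul m hm h0 t (U f) - U f),
      Lp.coeFn_sub (expMul m hm h0 t (U f)) (U f),
      coeFn_expMul (hm := hm) (h0 := h0) t (U f)] with x h1 h2 h3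
    rw [hu]
    simp only
    rw [h1, Pi.smul_apply, h2, Pi.sub_apply, h3, smul_eq_mul]
    push_cast
    ring
  have hpt : ∀ k : ℕ → ℝ≥0, Tendsto k atTop (𝓝[>] 0) →
      ∀ᵐ x ∂μ, Tendsto (fun i => u (k i) x) atTop (𝓝 (-(m x : ℂ) * U f x)) := by
    intro k hk
    filter_upwards [ae_all_iff.2 fun i => hcoe (k i)] with x hx
    simp_rw [hx]
    have h1 := (tendsto_exp_neg_mul_sub_one_div (m x)).comp (tendsto_coe_nhdsGT_zero.comp hk)
    have h2 := ((Complex.continuous_ofReal.tendsto _).comp h1).mul_const (U f x)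
    simpa [Function.comp_def] using h2
  have key : Tendsto (fun t : ℝ≥0 => ((t : ℝ)⁻¹ : ℂ) • ((mulSemigroup U m hm h0).op t f - f))
      (𝓝[>] 0) (𝓝 g) ↔ Tendsto u (𝓝[>] 0) (𝓝 (U g)) := by
    have : u = U ∘ fun t : ℝ≥0 => ((t : ℝ)⁻¹ : ℂ) • ((mulSemigroup U m hm h0).op t f - f) :=
      funext fun t => (hU t).symm
    rw [this]
    exact U.toHomeomorph.isInducing.tendsto_nhds_iff
  rw [key]
  constructor
  · intro h
    obtain ⟨k, hk, hlim⟩ := (tendstoInMeasure_of_tendsto_Lp h).exists_seq_tendsto_ae'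
    filter_upwards [hlim, hpt k hk] with x h1 h2
    exact tendsto_nhds_unique h1 h2
  · intro h
    refine tendsto_Lp_two_of_dominated (w := U g) ?_ fun k hk => ?_
    · filter_upwards [self_mem_nhdsWithin] with t ht
      filter_upwards [hcoe t, h] with x h1 h2
      rw [h1, h2, norm_mul, norm_mul, norm_neg, Complex.norm_real, Complex.norm_real,
        Real.norm_of_nonneg (h0 x)]
      gcongr
      exact abs_exp_neg_mul_sub_one_div_le (NNReal.coe_pos.2 ht) (h0 x)
    · filter_upwards [hpt k hk, h] with x h1 h2
      rwa [h2]

/-- An operator that is unitarily equivalent to the multiplication by `-m`, `m ≥ 0`, with maximal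
domain generates a semigroup, which is equivalent to the multiplication by `exp (-t m)`. -/
theorem isOperatorExp_of_unitary {H : Type*} [NormedAddCommGroup H] [InnerProductSpace ℂ H]
    (U : H ≃ₗᵢ[ℂ] Lp ℂ 2 μ) (hm : Measurable m) (h0 : ∀ x, 0 ≤ m x) {A : H →ₗ.[ℂ] H}
    {T : H →L[ℂ] H}
    (hA : ∀ f g, (f, g) ∈ A.graph ↔ U g =ᵐ[μ] fun x => -(m x : ℂ) * U f x)
    (hT : ∀ f, U (T f) =ᵐ[μ] fun x => ((Real.exp (-m x) : ℝ) : ℂ) * U f x) :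
    IsOperatorExp A T := by
  refine ⟨mulSemigroup U m hm h0, fun f g => ?_, ?_⟩
  · rw [tendsto_mulSemigroup_iff, hA]
  · ext1 f
    apply U.injective
    change U (U.symm (expMul m hm h0 1 (U f))) = _
    rw [U.apply_symm_apply]
    apply Lp.ext
    filter_upwards [coeFn_expMul (hm := hm) (h0 := h0) 1 (U f), hT f] with x h1 h2
    rw [h1, h2]
    simp

end

/-! ### Diagonal operators -/

theorem eLpNorm_two_count (a : ℕ → ℂ) :
    eLpNorm a 2 Measure.count = (∑' n, ‖a n‖ₑ ^ (2 : ℝ)) ^ (1 / 2 : ℝ) := by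
  rw [eLpNorm_eq_lintegral_rpow_enorm_toReal (by norm_num) (by norm_num), lintegral_count]
  norm_num

theorem memLp_two_count_iff {a : ℕ → ℂ} : MemLp a 2 Measure.count ↔ Memℓp a 2 := by
  have h1 : ∀ n, ‖a n‖ₑ ^ (2 : ℝ) = ENNReal.ofReal (‖a n‖ ^ (2 : ℝ)) := fun n => by
    rw [← ofReal_norm, ENNReal.ofReal_rpow_of_nonneg (norm_nonneg _) zero_le_two]
  rw [memℓp_gen_iff (by norm_num), MemLp, eLpNorm_two_count]
  simp only [h1, ENNReal.toReal_ofNat]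
  rw [ENNReal.rpow_lt_top_iff_of_pos (by norm_num)]
  constructor
  · rintro ⟨-, h⟩
    have := ENNReal.summable_toReal h.ne
    refine this.congr fun n => ?_
    rw [ENNReal.toReal_ofReal (by positivity)]
  · intro h
    refine ⟨(measurable_of_countable a).aestronglyMeasurable, ?_⟩
    rw [← ENNReal.ofReal_tsum_of_nonneg (fun n => by positivity) h]
    exact ENNReal.ofReal_lt_top

/-- The coordinates in a Hilbert basis give a unitary map onto `L²` of the counting measure. -/
theorem HilbertBasis.exists_unitary_count {H : Type*} [NormedAddCommGroup H]
    [InnerProductSpace ℂ H] (b : HilbertBasis ℕ ℂ H) :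
    ∃ U : H ≃ₗᵢ[ℂ] Lp ℂ 2 (Measure.count : Measure ℕ),
      ∀ f, U f =ᵐ[Measure.count] fun n => inner ℂ (b n) f := by
  have hmem : ∀ f : H, MemLp (fun n => inner ℂ (b n) f) 2 (Measure.count : Measure ℕ) := by
    intro f
    rw [memLp_two_count_iff]
    simp_rw [← b.repr_apply_apply]
    exact (b.repr f).2
  let U₀ : H →ₗᵢ[ℂ] Lp ℂ 2 (Measure.count : Measure ℕ) :=
    { toFun := fun f => (hmem f).toLp _
      map_add' := fun f g => by
        rw [← MemLp.toLp_add]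
        apply MemLp.toLp_congr
        exact Eventually.of_forall fun n => inner_add_right _ _ _
      map_smul' := fun a f => by
        rw [RingHom.id_apply, ← MemLp.toLp_const_smul]
        apply MemLp.toLp_congr
        exact Eventually.of_forall fun n => inner_smul_right _ _ _
      norm_map' := fun f => by
        change ‖(hmem f).toLp _‖ = _
        have h1 : ∀ n, ‖(inner ℂ (b n) f : ℂ)‖ₑ ^ (2 : ℝ)
            = ENNReal.ofReal (‖(b.repr f) n‖ ^ (2 : ℝ)) := fun n => by
          rw [← ofReal_norm, ENNReal.ofReal_rpow_of_nonneg (norm_nonneg _) zero_le_two,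
            b.repr_apply_apply]
        have hs := lp.hasSum_norm (p := 2) (by norm_num) (b.repr f)
        simp only [ENNReal.toReal_ofNat] at hs
        rw [Lp.norm_toLp, eLpNorm_two_count]
        simp_rw [h1]
        rw [← ENNReal.ofReal_tsum_of_nonneg (fun n => by positivity) hs.summable, hs.tsum_eq,
          ENNReal.ofReal_rpow_of_nonneg (by positivity) (by norm_num),
          ENNReal.toReal_ofReal (by positivity), ← Real.rpow_mul (norm_nonneg _)]
        norm_num }
  have hU₀ : ∀ f, U₀ f =ᵐ[Measure.count] fun n => inner ℂ (b n) f :=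
    fun f => (hmem f).coeFn_toLp
  have hsurj : Function.Surjective U₀ := by
    intro h
    refine ⟨b.repr.symm ⟨⇑h, memLp_two_count_iff.1 (Lp.memLp h)⟩, ?_⟩
    apply Lp.ext
    filter_upwards [hU₀ (b.repr.symm ⟨⇑h, memLp_two_count_iff.1 (Lp.memLp h)⟩)] with n hn
    rw [hn, ← b.repr_apply_apply, LinearIsometryEquiv.apply_symm_apply]
  exact ⟨LinearIsometryEquiv.ofSurjective U₀ hsurj, hU₀⟩

/-- An operator that is diagonal in a Hilbert basis, with eigenvalues `-m n ≤ 0` and maximal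
domain, generates a semigroup, which is diagonal in this basis. -/
theorem HilbertBasis.isOperatorExp_of_diagonal {H : Type*} [NormedAddCommGroup H]
    [InnerProductSpace ℂ H] (b : HilbertBasis ℕ ℂ H) {m : ℕ → ℝ} (h0 : ∀ n, 0 ≤ m n)
    {A : H →ₗ.[ℂ] H} {T : H →L[ℂ] H}
    (hA : ∀ f g, (f, g) ∈ A.graph ↔ ∀ n, (inner ℂ (b n) g : ℂ) = -(m n : ℂ) * inner ℂ (b n) f)
    (hT : ∀ f n, (inner ℂ (b n) (T f) : ℂ) = ((Real.exp (-m n) : ℝ) : ℂ) * inner ℂ (b n) f) :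
    IsOperatorExp A T := by
  obtain ⟨U, hU⟩ := b.exists_unitary_count
  simp only [EventuallyEq, Measure.ae_count_iff] at hU
  refine isOperatorExp_of_unitary U (measurable_of_countable m) h0 (fun f g => ?_) fun f => ?_
  · rw [hA]
    simp only [EventuallyEq, Measure.ae_count_iff, hU]
  · simp only [EventuallyEq, Measure.ae_count_iff, hU, hT, implies_true]

/-! ### Generators and multiplication operators on tempered distributions -/

theorem mem_graph_smul_iff {A : L2R →ₗ.[ℂ] L2R} {c : ℂ} {f g : L2R} :
    (f, g) ∈ (c • A).graph ↔ ∃ g', (f, g') ∈ A.graph ∧ g = c • g' := by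
  simp only [LinearPMap.mem_graph_iff]
  constructor
  · rintro ⟨y, hy, hg⟩
    exact ⟨A y, ⟨y, hy, rfl⟩, hg.symm⟩
  · rintro ⟨g', ⟨y, hy, rfl⟩, rfl⟩
    exact ⟨y, hy, rfl⟩

theorem mem_graph_neg_iff {A : L2R →ₗ.[ℂ] L2R} {f g : L2R} :
    (f, g) ∈ (-A).graph ↔ ∃ g', (f, g') ∈ A.graph ∧ g = -g' := by
  simp only [LinearPMap.mem_graph_iff]
  constructor
  · rintro ⟨y, hy, hg⟩
    exact ⟨A y, ⟨y, hy, rfl⟩, hg.symm⟩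
  · rintro ⟨g', ⟨y, hy, rfl⟩, rfl⟩
    exact ⟨y, hy, rfl⟩

/-- An `L²` function is the product of a smooth function of temperate growth and an `L²` function
in the sense of distributions if and only if it is so almost everywhere. -/
theorem toTemperedDistribution_eq_smulLeftCLM_iff {a : ℝ → ℂ} (ha : a.HasTemperateGrowth)
    (f g : L2R) :
    (g : 𝓢'(ℝ, ℂ)) = TemperedDistribution.smulLeftCLM ℂ a (f : 𝓢'(ℝ, ℂ))
      ↔ g =ᵐ[volume] fun x => a x * f x := by
  constructor
  · intro h
    have hloc : LocallyIntegrable (f : ℝ → ℂ) volume :=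
      (Lp.memLp f).locallyIntegrable (by norm_num)
    -- Compactly supported smooth functions are Schwartz functions, so the equality of distributions
    -- may be tested on them; local integrability of both sides then gives a.e. equality.
    have hac : Continuous a := ha.1.continuous
    refine ae_eq_of_integral_contDiff_smul_eq ((Lp.memLp g).locallyIntegrable (by norm_num)) ?_ ?_
    · refine locallyIntegrableOn_univ.1 ?_
      exact (locallyIntegrableOn_univ.2 hloc).continuousOn_mul hac.continuousOn
        isOpen_univ.isLocallyClosed
    · intro φ hφ hsupp
      have h₁ : HasCompactSupport (Complex.ofRealCLM ∘ φ) := hsupp.comp_left rfl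
      have h₂ : ContDiff ℝ ((⊤ : ℕ∞) : WithTop ℕ∞) (Complex.ofRealCLM ∘ φ) := by fun_prop
      have := DFunLike.congr_fun h (h₁.toSchwartzMap h₂)
      rw [TemperedDistribution.smulLeftCLM_apply_apply, Lp.toTemperedDistribution_apply,
        Lp.toTemperedDistribution_apply] at this
      simp only [SchwartzMap.smulLeftCLM_apply_apply ha] at this
      have hval : ∀ x, h₁.toSchwartzMap h₂ x = (φ x : ℂ) := fun _ => rfl
      simp only [hval, smul_eq_mul] at this
      simp only [Complex.real_smul]
      rw [this]
      congr 1
      ext x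
      ring
  · intro h
    ext φ
    rw [TemperedDistribution.smulLeftCLM_apply_apply, Lp.toTemperedDistribution_apply,
      Lp.toTemperedDistribution_apply]
    refine integral_congr_ae ?_
    filter_upwards [h] with x hx
    rw [hx, SchwartzMap.smulLeftCLM_apply_apply ha]
    simp only [smul_eq_mul]
    ring

theorem neg_two_pi_sq_eq_smul :
    (fun x : ℝ => -(((2 * Real.pi * x) ^ 2 : ℝ) : ℂ))
      = ((-(2 * Real.pi) ^ 2 : ℝ) : ℂ) • fun x : ℝ => Complex.ofReal (‖x‖ ^ 2) := by
  ext x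
  rw [Pi.smul_apply, smul_eq_mul, Real.norm_eq_abs, sq_abs]
  push_cast
  ring

theorem hasTemperateGrowth_ofReal_norm_sq :
    (fun x : ℝ => Complex.ofReal (‖x‖ ^ 2)).HasTemperateGrowth := by
  fun_prop

theorem hasTemperateGrowth_neg_two_pi_sq :
    (fun x : ℝ => -(((2 * Real.pi * x) ^ 2 : ℝ) : ℂ)).HasTemperateGrowth := by
  have : (fun x : ℝ => -(((2 * Real.pi * x) ^ 2 : ℝ) : ℂ))
      = fun x : ℝ => (-(2 * Real.pi : ℂ) ^ 2) * (Complex.ofReal x) ^ 2 := by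
    ext x
    push_cast
    ring
  rw [this]
  fun_prop

theorem fourier_laplacian_eq_smulLeftCLM (f : 𝓢'(ℝ, ℂ)) :
    𝓕 (Δ f) = TemperedDistribution.smulLeftCLM ℂ
      (fun x : ℝ => -(((2 * Real.pi * x) ^ 2 : ℝ) : ℂ)) (𝓕 f) := by
  rw [TemperedDistribution.laplacian_eq_fourierMultiplierCLM,
    TemperedDistribution.fourierMultiplierCLM_apply, ← Complex.coe_smul,
    FourierTransform.fourier_smul, FourierTransform.fourier_fourierInv_eq, neg_two_pi_sq_eq_smul,
    TemperedDistribution.smulLeftCLM_smul hasTemperateGrowth_ofReal_norm_sq]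
  rfl

/-- The Laplacian with maximal domain is the Fourier multiplier `-(2πη)²` with maximal domain. -/
theorem mem_graph_laplacianL2_iff (f g : L2R) :
    (f, g) ∈ laplacianL2.graph ↔
      (𝓕 g : L2R) =ᵐ[volume] fun η => -(((2 * Real.pi * η) ^ 2 : ℝ) : ℂ) * (𝓕 f : L2R) η := by
  rw [← toTemperedDistribution_eq_smulLeftCLM_iff hasTemperateGrowth_neg_two_pi_sq, laplacianL2,
    mem_graph_maximalRealization, TemperedDistribution.laplacianCLM_apply,
    ← Lp.fourier_toTemperedDistribution_eq, ← Lp.fourier_toTemperedDistribution_eq,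
    ← fourier_laplacian_eq_smulLeftCLM]
  -- The Fourier transform is injective on tempered distributions, so g = Δf may be checked after
  -- transforming.
  exact (FourierTransform.fourierEquiv ℂ 𝓢'(ℝ, ℂ)).injective.eq_iff.symm

/-! ### The filters -/

theorem coeFn_spaceFilter (m : Lp ℂ ∞ (volume : Measure ℝ)) (f : L2R) :
    spaceFilter m f =ᵐ[volume] fun x => m x * f x :=
  (ContinuousLinearMap.mul ℂ ℂ).coeFn_holder (r := 2) m f

theorem coeFn_dilation {c : ℝ} (hc : c ≠ 0) (f : L2R) :
    dilation c hc f =ᵐ[volume] fun x => f (c * x) :=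
  (memLp_dilation hc f).coeFn_toLp

/-- The two dilations cancel on 𝓕 f and leave the mask evaluated at the angular frequency ξ = 2πη.
-/
theorem fourier_fourierFilter (m : Lp ℂ ∞ (volume : Measure ℝ)) (f : L2R) :
    (𝓕 (fourierFilter m f) : L2R) =ᵐ[volume]
      fun η => m (2 * Real.pi * η) * (𝓕 f : L2R) η := by
  have h1 : (𝓕 (fourierFilter m f) : L2R)
      = dilation (2 * Real.pi) Real.two_pi_pos.ne' (spaceFilter m
        (dilation (2 * Real.pi)⁻¹ (inv_ne_zero Real.two_pi_pos.ne') (𝓕 f : L2R))) :=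
    (Lp.fourierTransformₗᵢ ℝ ℂ).apply_symm_apply _
  rw [h1]
  have hq := quasiMeasurePreserving_dilation Real.two_pi_pos.ne'
  filter_upwards [coeFn_dilation Real.two_pi_pos.ne' (spaceFilter m
        (dilation (2 * Real.pi)⁻¹ (inv_ne_zero Real.two_pi_pos.ne') (𝓕 f : L2R))),
    hq.ae (coeFn_spaceFilter m
        (dilation (2 * Real.pi)⁻¹ (inv_ne_zero Real.two_pi_pos.ne') (𝓕 f : L2R))),
    hq.ae (coeFn_dilation (inv_ne_zero Real.two_pi_pos.ne') (𝓕 f : L2R))] with η h2 h3 h4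
  rw [h2, h3, h4, inv_mul_cancel_left₀ Real.two_pi_pos.ne']

theorem adjoint_spaceFilter {m : Lp ℂ ∞ (volume : Measure ℝ)} {r : ℝ → ℝ}
    (hm : m =ᵐ[volume] fun x => (r x : ℂ)) : (spaceFilter m).adjoint = spaceFilter m := by
  refine ((ContinuousLinearMap.eq_adjoint_iff _ _).2 fun f g => ?_).symm
  rw [L2.inner_def, L2.inner_def]
  refine integral_congr_ae ?_
  filter_upwards [coeFn_spaceFilter m f, coeFn_spaceFilter m g, hm] with x h1 h2 h3
  rw [h1, h2, h3]
  simp only [RCLike.inner_apply, map_mul, Complex.conj_ofReal]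
  ring

/-- By Plancherel, the inner products may be computed on the Fourier side, where the filter is
multiplication by a real function. -/
theorem adjoint_fourierFilter {m : Lp ℂ ∞ (volume : Measure ℝ)} {r : ℝ → ℝ}
    (hm : m =ᵐ[volume] fun x => (r x : ℂ)) : (fourierFilter m).adjoint = fourierFilter m := by
  refine ((ContinuousLinearMap.eq_adjoint_iff _ _).2 fun f g => ?_).symm
  rw [← Lp.inner_fourier_eq, ← Lp.inner_fourier_eq f, L2.inner_def, L2.inner_def]
  refine integral_congr_ae ?_
  filter_upwards [fourier_fourierFilter m f, fourier_fourierFilter m g,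
    (quasiMeasurePreserving_dilation Real.two_pi_pos.ne').ae hm] with x h1 h2 h3
  rw [h1, h2, h3]
  simp only [RCLike.inner_apply, map_mul, Complex.conj_ofReal]
  ring

theorem fourier_fourierFilter_gaussian {β : ℝ} {mF : Lp ℂ ∞ (volume : Measure ℝ)}
    (hF : mF =ᵐ[volume] fun ξ : ℝ => ((Real.exp (-(β / 2) * ξ ^ 2) : ℝ) : ℂ)) (f : L2R) :
    (𝓕 (fourierFilter mF (fourierFilter mF f)) : L2R) =ᵐ[volume]
      fun η => ((Real.exp (-(β * (2 * Real.pi * η) ^ 2)) : ℝ) : ℂ) * (𝓕 f : L2R) η := by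
  filter_upwards [fourier_fourierFilter mF f, fourier_fourierFilter mF (fourierFilter mF f),
    (quasiMeasurePreserving_dilation Real.two_pi_pos.ne').ae hF] with η h1 h2 h3
  rw [h2, h1, h3, ← mul_assoc, ← Complex.ofReal_mul, ← Real.exp_add]
  congr 3
  ring

theorem isOperatorExp_laplacianL2 {β : ℝ} (hβ : 0 < β) {mF : Lp ℂ ∞ (volume : Measure ℝ)}
    (hF : mF =ᵐ[volume] fun ξ : ℝ => ((Real.exp (-(β / 2) * ξ ^ 2) : ℝ) : ℂ)) :
    IsOperatorExp ((β : ℂ) • laplacianL2) (fourierFilter mF ∘L fourierFilter mF) := by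
  have hβ' : (β : ℂ) ≠ 0 := Complex.ofReal_ne_zero.2 hβ.ne'
  refine isOperatorExp_of_unitary (m := fun η => β * (2 * Real.pi * η) ^ 2)
    (Lp.fourierTransformₗᵢ ℝ ℂ) (by fun_prop) (fun η => by positivity) (fun f g => ?_)
    fun f => fourier_fourierFilter_gaussian hF f
  rw [mem_graph_smul_iff]
  change _ ↔ (𝓕 g : L2R) =ᵐ[volume] fun η => -((β * (2 * Real.pi * η) ^ 2 : ℝ) : ℂ) * (𝓕 f : L2R) η
  simp only [mem_graph_laplacianL2_iff]
  constructor
  · rintro ⟨g', h, rfl⟩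
    rw [FourierTransform.fourier_smul]
    filter_upwards [h, Lp.coeFn_smul (β : ℂ) (𝓕 g' : L2R)] with η h1 h2
    rw [h2, Pi.smul_apply, h1, smul_eq_mul]
    push_cast
    ring
  · intro h
    refine ⟨(β : ℂ)⁻¹ • g, ?_, (smul_inv_smul₀ hβ' g).symm⟩
    rw [FourierTransform.fourier_smul]
    filter_upwards [h, Lp.coeFn_smul (β : ℂ)⁻¹ (𝓕 g : L2R)] with η h1 h2
    rw [h2, Pi.smul_apply, h1, smul_eq_mul]
    push_cast
    field_simp

theorem concentrationOp_eq {mS mF : Lp ℂ ∞ (volume : Measure ℝ)} {rS rF : ℝ → ℝ}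
    (hS : mS =ᵐ[volume] fun x => (rS x : ℂ)) (hF : mF =ᵐ[volume] fun x => (rF x : ℂ)) :
    concentrationOp mS mF
      = spaceFilter mS ∘L (fourierFilter mF ∘L fourierFilter mF) ∘L spaceFilter mS := by
  rw [concentrationOp, adjoint_spaceFilter hS, adjoint_fourierFilter hF]
  rfl

/-! ### Products of polynomials and Gaussians -/

-- For monomials, combine |x|ⁿ ≤ n! e^{|x|} with |x| − x²/2 ≤ 1/2. This is the decay estimate that
-- makes the Gaussian a Schwartz function.
open Polynomial in
theorem exists_eval_mul_exp_neg_le (P : ℝ[X]) :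
    ∃ C : ℝ, ∀ x : ℝ, |P.eval x| * Real.exp (-(x ^ 2 / 2)) ≤ C := by
  induction P using Polynomial.induction_on' with
  | add p q hp hq =>
    obtain ⟨C, hC⟩ := hp
    obtain ⟨D, hD⟩ := hq
    refine ⟨C + D, fun x => ?_⟩
    rw [eval_add]
    calc _ ≤ (|p.eval x| + |q.eval x|) * Real.exp (-(x ^ 2 / 2)) := by
          gcongr
          exact abs_add_le _ _
      _ ≤ C + D := by
          rw [add_mul]
          exact add_le_add (hC x) (hD x)
  | monomial n a =>
    refine ⟨|a| * (n.factorial * Real.exp (1 / 2)), fun x => ?_⟩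
    have h1 : |x| ^ n ≤ n.factorial * Real.exp |x| := by
      have := Real.pow_div_factorial_le_exp |x| (abs_nonneg x) n
      rwa [div_le_iff₀' (by positivity)] at this
    have h2 : |x| + -(x ^ 2 / 2) ≤ 1 / 2 := by
      rw [← sq_abs x]
      nlinarith [sq_nonneg (|x| - 1)]
    rw [eval_monomial, abs_mul, abs_pow, mul_assoc]
    refine mul_le_mul_of_nonneg_left ?_ (abs_nonneg a)
    calc |x| ^ n * Real.exp (-(x ^ 2 / 2))
        ≤ n.factorial * Real.exp |x| * Real.exp (-(x ^ 2 / 2)) := by gcongr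
      _ = n.factorial * Real.exp (|x| + -(x ^ 2 / 2)) := by rw [Real.exp_add, mul_assoc]
      _ ≤ _ := by gcongr

/-- The Gaussian `exp (-x² / 2)` as a real Schwartz function. -/
noncomputable def schwartzGaussian : 𝓢(ℝ, ℝ) where
  toFun x := Real.exp (-(x ^ 2 / 2))
  smooth' := by fun_prop
  decay' k n := by
    -- The n-th derivative of the Gaussian is ±He_n times the Gaussian, so the seminorm concerns the
    -- polynomial Xᵏ He_n.
    obtain ⟨C, hC⟩ := exists_eval_mul_exp_neg_le
      (Polynomial.X ^ k * (Polynomial.hermite n).map (Int.castRingHom ℝ))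
    refine ⟨C, fun x => ?_⟩
    refine le_trans (le_of_eq ?_) (hC x)
    rw [norm_iteratedFDeriv_eq_norm_iteratedDeriv, iteratedDeriv_eq_iterate,
      Polynomial.deriv_gaussian_eq_hermite_mul_gaussian, Polynomial.eval_mul, Polynomial.eval_pow,
      Polynomial.eval_X, Polynomial.eval_map, Polynomial.aeval_def, norm_mul, norm_mul, norm_pow,
      norm_neg, norm_one, one_pow, one_mul, Real.norm_eq_abs, Real.norm_eq_abs,
      Real.norm_of_nonneg (Real.exp_pos _).le, abs_mul, abs_pow, mul_assoc]
    rfl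

theorem hasTemperateGrowth_eval (P : Polynomial ℝ) :
    (fun x : ℝ => ((P.eval x : ℝ) : ℂ)).HasTemperateGrowth := by
  have h : (fun x : ℝ => P.eval x).HasTemperateGrowth := by
    induction P using Polynomial.induction_on' with
    | add p q hp hq => simpa [Pi.add_def] using hp.add hq
    | monomial n a =>
      simp only [Polynomial.eval_monomial]
      fun_prop
  exact Function.HasTemperateGrowth.comp (g := Complex.ofReal) (by fun_prop) h

/-- The Schwartz function `P(x) exp (-p x² / 2)` for a polynomial `P` and `p > 0`. -/
noncomputable def polyGaussian (p : ℝ) (hp : 0 < p) (P : Polynomial ℝ) : 𝓢(ℝ, ℂ) :=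
  SchwartzMap.smulLeftCLM ℂ (fun x : ℝ => ((P.eval x : ℝ) : ℂ))
    (SchwartzMap.compCLMOfContinuousLinearEquiv ℝ
      (ContinuousLinearEquiv.unitsEquivAut ℝ (Units.mk0 √p (Real.sqrt_pos.2 hp).ne'))
      (schwartzGaussian.postcompCLM Complex.ofRealCLM))

theorem polyGaussian_apply (p : ℝ) (hp : 0 < p) (P : Polynomial ℝ) (x : ℝ) :
    polyGaussian p hp P x = ((P.eval x * Real.exp (-(p * x ^ 2 / 2)) : ℝ) : ℂ) := by
  rw [polyGaussian, SchwartzMap.smulLeftCLM_apply_apply (hasTemperateGrowth_eval P)]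
  have : (SchwartzMap.compCLMOfContinuousLinearEquiv ℝ
      (ContinuousLinearEquiv.unitsEquivAut ℝ (Units.mk0 √p (Real.sqrt_pos.2 hp).ne'))
      (schwartzGaussian.postcompCLM Complex.ofRealCLM)) x
      = ((Real.exp (-((x * √p) ^ 2 / 2)) : ℝ) : ℂ) := rfl
  rw [this, mul_pow, Real.sq_sqrt hp.le, smul_eq_mul, ← Complex.ofReal_mul, mul_comm p]

section

open Polynomial

variable {p : ℝ} {hp : 0 < p}

theorem polyGaussian_add (P Q : ℝ[X]) :
    polyGaussian p hp (P + Q) = polyGaussian p hp P + polyGaussian p hp Q := by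
  ext x
  simp only [add_apply, polyGaussian_apply, eval_add]
  push_cast
  ring

theorem polyGaussian_smul (a : ℝ) (P : ℝ[X]) :
    polyGaussian p hp (a • P) = (a : ℂ) • polyGaussian p hp P := by
  ext x
  simp only [smul_apply, polyGaussian_apply, eval_smul, smul_eq_mul]
  push_cast
  ring

/-- Polynomials times a fixed Gaussian are closed under differentiation, which reduces the later
calculus to algebra of the polynomial factor. -/
theorem hasDerivAt_polyGaussian (P : ℝ[X]) (x : ℝ) :
    HasDerivAt (polyGaussian p hp P)
      (polyGaussian p hp (derivative P - C p * X * P) x) x := by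
  have h1 : HasDerivAt (fun x : ℝ => Real.exp (-(p * x ^ 2 / 2)))
      (Real.exp (-(p * x ^ 2 / 2)) * -(p * x)) x := by
    have : HasDerivAt (fun x : ℝ => -(p * x ^ 2 / 2)) (-(p * x)) x := by
      have h := (((hasDerivAt_pow 2 x).const_mul p).div_const 2).neg
      refine h.congr_deriv ?_
      push_cast
      ring
    exact this.exp
  have h2 := ((P.hasDerivAt x).mul h1).ofReal_comp
  have h3 : (polyGaussian p hp P : ℝ → ℂ)
      = fun x => ((P.eval x * Real.exp (-(p * x ^ 2 / 2)) : ℝ) : ℂ) :=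
    funext fun x => polyGaussian_apply p hp P x
  rw [h3]
  refine h2.congr_deriv ?_
  rw [polyGaussian_apply]
  simp only [eval_sub, eval_mul, eval_C, eval_X]
  push_cast
  ring

theorem deriv_polyGaussian (P : ℝ[X]) :
    deriv (polyGaussian p hp P) = polyGaussian p hp (derivative P - C p * X * P) :=
  funext fun x => (hasDerivAt_polyGaussian P x).deriv

theorem integral_polyGaussian_derivative (P : ℝ[X]) :
    ∫ x, polyGaussian p hp (derivative P - C p * X * P) x = 0 :=
  integral_eq_zero_of_hasDerivAt_of_integrable (hasDerivAt_polyGaussian P)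
    (SchwartzMap.integrable _) (SchwartzMap.integrable _)

/-! ### Hermite polynomials -/

/-- Induction by differentiating He_{n+1} = X He_n − He_n'. This is the lowering relation. -/
theorem derivative_hermite_succ (n : ℕ) :
    derivative (hermite (n + 1)) = ((n + 1 : ℕ) : ℤ[X]) * hermite n := by
  induction n with
  | zero => simp
  | succ n ih =>
    rw [hermite_succ (n + 1), derivative_sub, derivative_mul, derivative_X, one_mul, ih,
      derivative_mul, derivative_natCast, zero_mul, zero_add, hermite_succ n]
    push_cast
    ring

/-- The polynomial `He_n(√(2ω) x)`. -/
noncomputable def hermitePoly (ω : ℝ) (n : ℕ) : ℝ[X] :=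
  ((hermite n).map (Int.castRingHom ℝ)).comp (C √(2 * ω) * X)

theorem eval_hermitePoly (ω : ℝ) (n : ℕ) (x : ℝ) :
    (hermitePoly ω n).eval x = aeval (√(2 * ω) * x) (hermite n) := by
  simp [hermitePoly, eval_comp, eval_map, aeval_def]

theorem hermitePoly_zero (ω : ℝ) : hermitePoly ω 0 = 1 := by
  simp [hermitePoly]

theorem derivative_hermitePoly (ω : ℝ) (n : ℕ) :
    derivative (hermitePoly ω n)
      = C √(2 * ω) * (derivative ((hermite n).map (Int.castRingHom ℝ))).comp (C √(2 * ω) * X) := by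
  rw [hermitePoly, derivative_comp]
  simp

/-- The raising relation: differentiating He_n(√(2ω) x) e^{-ωx²} produces −√(2ω) times the next
function of this kind. It drives both the integration by parts and the induction for the heat
operator. -/
theorem smul_hermitePoly_succ {ω : ℝ} (hω : 0 < ω) (n : ℕ) :
    √(2 * ω) • hermitePoly ω (n + 1)
      = C (2 * ω) * X * hermitePoly ω n - derivative (hermitePoly ω n) := by
  have h : C (2 * ω) = C √(2 * ω) * C √(2 * ω) := by
    rw [← C_mul, Real.mul_self_sqrt (by positivity)]
  rw [derivative_hermitePoly, hermitePoly, hermite_succ, smul_eq_C_mul, h, hermitePoly]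
  simp only [Polynomial.map_sub, Polynomial.map_mul, map_X, sub_comp, mul_comp, X_comp,
    derivative_map]
  ring

theorem derivative_hermitePoly_succ (ω : ℝ) (n : ℕ) :
    derivative (hermitePoly ω (n + 1)) = ((n + 1 : ℕ) * √(2 * ω)) • hermitePoly ω n := by
  rw [derivative_hermitePoly, derivative_map, derivative_hermite_succ, hermitePoly, smul_eq_C_mul]
  simp only [Polynomial.map_mul, Polynomial.map_natCast, mul_comp, natCast_comp, C_mul, C_eq_natCast]
  ring

theorem degree_hermitePoly {ω : ℝ} (hω : 0 < ω) (n : ℕ) : (hermitePoly ω n).degree = n := by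
  have h1 : (C √(2 * ω) * X : ℝ[X]).natDegree = 1 :=
    natDegree_C_mul_X _ (Real.sqrt_pos.2 (by positivity)).ne'
  have h2 : ((hermite n).map (Int.castRingHom ℝ)).natDegree = n := by
    rw [(hermite_monic n).natDegree_map, natDegree_hermite]
  have h3 : (hermitePoly ω n).natDegree = n := by
    rw [hermitePoly, natDegree_comp, h1, h2, mul_one]
  rcases Nat.eq_zero_or_pos n with rfl | hn
  · simp [hermitePoly_zero]
  · rw [degree_eq_iff_natDegree_eq_of_pos hn, h3]

theorem span_range_hermitePoly {ω : ℝ} (hω : 0 < ω) :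
    Submodule.span ℝ (Set.range (hermitePoly ω)) = ⊤ := by
  let S : Polynomial.Sequence ℝ := ⟨hermitePoly ω, degree_hermitePoly hω⟩
  exact S.span fun i => isUnit_iff_ne_zero.2 (leadingCoeff_ne_zero.2 (S.ne_zero i))

/-- Repeated integration by parts against the weight `exp (-ω x²)`. -/
theorem integral_polyGaussian_mul_hermitePoly {ω : ℝ} (hω : 0 < ω) (h2ω : 0 < 2 * ω) (n : ℕ)
    (P : ℝ[X]) :
    ((√(2 * ω) ^ n : ℝ) : ℂ) * ∫ x, polyGaussian (2 * ω) h2ω (P * hermitePoly ω n) x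
      = ∫ x, polyGaussian (2 * ω) h2ω (derivative^[n] P) x := by
  induction n generalizing P with
  | zero => simp [hermitePoly_zero]
  | succ n ih =>
    have h0 := integral_polyGaussian_derivative (hp := h2ω) (P * hermitePoly ω n)
    -- The bracket is the polynomial factor of the derivative of P H_n e^{-ωx²}, so its integral
    -- vanishes.
    have h1 : derivative P * hermitePoly ω n = √(2 * ω) • (P * hermitePoly ω (n + 1))
        + (derivative (P * hermitePoly ω n) - C (2 * ω) * X * (P * hermitePoly ω n)) := by
      rw [← mul_smul_comm, smul_hermitePoly_succ hω, derivative_mul]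
      ring
    rw [Function.iterate_succ_apply, ← ih, h1, polyGaussian_add, polyGaussian_smul]
    simp only [add_apply, smul_apply, smul_eq_mul]
    rw [integral_add ((SchwartzMap.integrable _).const_mul _) (SchwartzMap.integrable _), h0,
      add_zero, integral_const_mul, pow_succ]
    push_cast
    ring

theorem iterate_derivative_hermitePoly (ω : ℝ) (n : ℕ) :
    derivative^[n] (hermitePoly ω n) = (n.factorial * √(2 * ω) ^ n : ℝ) • (1 : ℝ[X]) := by
  induction n with
  | zero => simp [hermitePoly_zero]
  | succ n ih =>
    rw [Function.iterate_succ_apply, derivative_hermitePoly_succ, iterate_derivative_smul, ih,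
      smul_smul, Nat.factorial_succ, pow_succ]
    congr 1
    push_cast
    ring

theorem integral_polyGaussian_one :
    ∫ x, polyGaussian p hp 1 x = ((√(2 * Real.pi / p) : ℝ) : ℂ) := by
  have h : ∀ x, polyGaussian p hp 1 x = ((Real.exp (-(p / 2) * x ^ 2) : ℝ) : ℂ) := fun x => by
    rw [polyGaussian_apply, eval_one, one_mul]
    congr 2
    ring
  simp_rw [h]
  rw [integral_complex_ofReal, integral_gaussian]
  congr 2
  field_simp

/-- Integrating by parts puts n derivatives on the factor of degree m. They annihilate it if m < n;
if m = n they leave n! √(2ω)ⁿ, whose power of √(2ω) cancels. -/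
theorem integral_hermitePoly_mul_hermitePoly {ω : ℝ} (hω : 0 < ω) (h2ω : 0 < 2 * ω) (m n : ℕ) :
    ∫ x, polyGaussian (2 * ω) h2ω (hermitePoly ω m * hermitePoly ω n) x
      = if m = n then ((n.factorial * √(Real.pi / ω) : ℝ) : ℂ) else 0 := by
  have hs : 0 < √(2 * ω) := Real.sqrt_pos.2 h2ω
  have hlt : ∀ {m n : ℕ}, m < n →
      ∫ x, polyGaussian (2 * ω) h2ω (hermitePoly ω m * hermitePoly ω n) x = 0 := by
    intro m n hmn
    have h := integral_polyGaussian_mul_hermitePoly hω h2ω n (hermitePoly ω m)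
    have hd : (hermitePoly ω m).natDegree < n :=
      (natDegree_eq_of_degree_eq_some (degree_hermitePoly hω m)).trans_lt hmn
    rw [iterate_derivative_eq_zero hd] at h
    have hz : ∀ x, polyGaussian (2 * ω) h2ω 0 x = 0 := fun x => by simp [polyGaussian_apply]
    simp only [hz, integral_zero, mul_eq_zero, Complex.ofReal_eq_zero] at h
    exact h.resolve_left (pow_pos hs n).ne'
  rcases lt_trichotomy m n with h | rfl | h
  · rw [if_neg h.ne, hlt h]
  · have h := integral_polyGaussian_mul_hermitePoly hω h2ω m (hermitePoly ω m)
    rw [iterate_derivative_hermitePoly, polyGaussian_smul] at h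
    simp only [smul_apply, smul_eq_mul] at h
    rw [integral_const_mul, integral_polyGaussian_one, mul_div_mul_left _ _ two_ne_zero] at h
    rw [if_pos rfl]
    have hne : ((√(2 * ω) ^ m : ℝ) : ℂ) ≠ 0 := Complex.ofReal_ne_zero.2 (pow_pos hs m).ne'
    apply mul_left_cancel₀ hne
    rw [h]
    push_cast
    ring
  · rw [if_neg h.ne', mul_comm (hermitePoly ω m), hlt h]

end

/-! ### Orthonormality and completeness of the Hermite functions -/

/-- The normalized eigenfunctions of `ω x² - ω⁻¹ Δ`, as Schwartz functions. -/
noncomputable def hermiteSchwartz (ω : ℝ) (hω : 0 < ω) (n : ℕ) : 𝓢(ℝ, ℂ) :=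
  ((√√ω / √(n.factorial * √Real.pi) : ℝ) : ℂ) • polyGaussian ω hω (hermitePoly ω n)

theorem hermiteSchwartz_apply {ω : ℝ} (hω : 0 < ω) (n : ℕ) (x : ℝ) :
    hermiteSchwartz ω hω n x = ((√√ω * hermiteFunction n (√ω * x) : ℝ) : ℂ) := by
  rw [hermiteSchwartz, smul_apply, polyGaussian_apply, eval_hermitePoly, hermiteFunction,
    smul_eq_mul, ← Complex.ofReal_mul, Real.sqrt_mul zero_le_two, mul_assoc √2, mul_pow,
    Real.sq_sqrt hω.le, neg_div]
  congr 1
  ring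

theorem conj_hermiteSchwartz {ω : ℝ} (hω : 0 < ω) (n : ℕ) (x : ℝ) :
    (starRingEnd ℂ) (hermiteSchwartz ω hω n x) = hermiteSchwartz ω hω n x := by
  rw [hermiteSchwartz_apply, Complex.conj_ofReal]

/-- The product of two Gaussians of parameter ω has parameter 2ω, which is the weight for which the
polynomials are orthogonal. -/
theorem orthonormal_hermiteSchwartz {ω : ℝ} (hω : 0 < ω) :
    Orthonormal ℂ fun n => (hermiteSchwartz ω hω n).toLp 2 (volume : Measure ℝ) := by
  rw [orthonormal_iff_ite]
  intro m n
  have h2ω : 0 < 2 * ω := by positivity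
  have hint : ∀ x, inner ℂ (hermiteSchwartz ω hω m x) (hermiteSchwartz ω hω n x)
      = ((√√ω / √(m.factorial * √Real.pi) * (√√ω / √(n.factorial * √Real.pi)) : ℝ) : ℂ)
        * polyGaussian (2 * ω) h2ω (hermitePoly ω m * hermitePoly ω n) x := by
    intro x
    rw [RCLike.inner_apply, conj_hermiteSchwartz, hermiteSchwartz, hermiteSchwartz, smul_apply,
      smul_apply, polyGaussian_apply, polyGaussian_apply, polyGaussian_apply,
      show -(2 * ω * x ^ 2 / 2) = -(ω * x ^ 2 / 2) + -(ω * x ^ 2 / 2) by ring, Real.exp_add,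
      Polynomial.eval_mul]
    simp only [smul_eq_mul]
    push_cast
    ring
  refine (SchwartzMap.inner_toL2_toL2_eq _ _ volume).trans ?_
  simp_rw [hint]
  rw [integral_const_mul, integral_hermitePoly_mul_hermitePoly hω]
  split_ifs with h
  · subst h
    rw [← Complex.ofReal_mul, Complex.ofReal_eq_one, div_mul_div_comm,
      Real.mul_self_sqrt (Real.sqrt_nonneg _), Real.mul_self_sqrt (by positivity),
      Real.sqrt_div Real.pi_pos.le]
    have h1 : 0 < √ω := Real.sqrt_pos.2 hω
    have h2 : 0 < √Real.pi := Real.sqrt_pos.2 Real.pi_pos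
    have h3 : (m.factorial : ℝ) ≠ 0 := by positivity
    field_simp
  · rw [mul_zero]

/-- An integrable function whose Fourier transform vanishes is zero. -/
theorem ae_eq_zero_of_fourier_eq_zero {g : ℝ → ℂ} (hg : Integrable g) (h : ∀ s, 𝓕 g s = 0) :
    ∀ᵐ x, g x = 0 := by
  refine ae_eq_zero_of_integral_contDiff_smul_eq_zero hg.locallyIntegrable fun φ hφ hsupp => ?_
  have h₁ : HasCompactSupport (Complex.ofRealCLM ∘ φ) := hsupp.comp_left rfl
  have h₂ : ContDiff ℝ ((⊤ : ℕ∞) : WithTop ℕ∞) (Complex.ofRealCLM ∘ φ) := by fun_prop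
  -- Writing the test function as φ = 𝓕 χ moves the transform onto g: ∫ φ g = ∫ χ 𝓕 g = 0.
  set χ : 𝓢(ℝ, ℂ) := 𝓕⁻ (h₁.toSchwartzMap h₂) with hχ
  have hφχ : ∀ x, 𝓕 (χ : ℝ → ℂ) x = φ x := by
    intro x
    have h3 : 𝓕 χ = h₁.toSchwartzMap h₂ := FourierTransform.fourier_fourierInv_eq _
    rw [← SchwartzMap.fourier_coe, h3]
    rfl
  have hflip : ∫ ξ, 𝓕 (χ : ℝ → ℂ) ξ • g ξ = ∫ x, χ x • 𝓕 g x := by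
    simpa using! VectorFourier.integral_fourierIntegral_smul_eq_flip (L := innerₗ ℝ)
      (μ := volume) (ν := volume) Real.continuous_fourierChar continuous_inner χ.integrable hg
  simp only [hφχ, h, smul_zero, integral_zero] at hflip
  exact hflip

/-- Expanding the exponential in the Fourier transform of e^{-px²/2} f gives a series whose terms
are multiples of the moments, which all vanish. Hence e^{-px²/2} f = 0, and the Gaussian has no
zeros. -/
theorem eq_zero_of_forall_integral_polyGaussian {p : ℝ} (hp : 0 < p) (f : L2R)
    (h : ∀ P : Polynomial ℝ, ∫ x, polyGaussian p hp P x * f x = 0) : f = 0 := by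
  have hint : ∀ φ : 𝓢(ℝ, ℂ), Integrable fun x => φ x * f x := fun φ =>
    (φ.memLp 2 volume).integrable_mul (Lp.memLp f)
  have hg : ∀ᵐ x, polyGaussian p hp 1 x * f x = 0 := by
    refine ae_eq_zero_of_fourier_eq_zero (hint _) fun s => ?_
    rw [Real.fourier_real_eq_integral_exp_smul]
    obtain ⟨z, hz⟩ : ∃ z : ℂ, z = ((-2 * Real.pi * s : ℝ) : ℂ) * Complex.I := ⟨_, rfl⟩
    have hterm : ∀ (n : ℕ) (x : ℝ), (z * x) ^ n / n.factorial * (polyGaussian p hp 1 x * f x)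
        = z ^ n / n.factorial * (polyGaussian p hp (Polynomial.X ^ n) x * f x) := by
      intro n x
      simp only [polyGaussian_apply, Polynomial.eval_one, Polynomial.eval_pow, Polynomial.eval_X]
      push_cast
      ring
    have hzero : ∀ n : ℕ,
        ∫ x : ℝ, (z * x) ^ n / n.factorial * (polyGaussian p hp 1 x * f x) = 0 := by
      intro n
      simp_rw [hterm]
      rw [integral_const_mul, h, mul_zero]
    have hsumm : ∀ x : ℝ, HasSum (fun n : ℕ => (‖z‖ * |x|) ^ n / n.factorial
        * ‖polyGaussian p hp 1 x * f x‖)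
        (Real.exp (‖z‖ * |x|) * ‖polyGaussian p hp 1 x * f x‖) := fun x => by
      have := NormedSpace.expSeries_div_hasSum_exp (𝔸 := ℝ) (‖z‖ * |x|)
      rw [← Real.exp_eq_exp_ℝ] at this
      exact this.mul_right _
    have hs := hasSum_integral_of_dominated_convergence (μ := volume)
      (F := fun (n : ℕ) (x : ℝ) => (z * x) ^ n / n.factorial * (polyGaussian p hp 1 x * f x))
      (f := fun x : ℝ => Complex.exp (z * x) * (polyGaussian p hp 1 x * f x))
      (fun n x => (‖z‖ * |x|) ^ n / n.factorial * ‖polyGaussian p hp 1 x * f x‖)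
      (fun n => ?_) (fun n => ?_) ?_ ?_ ?_
    · simp only [hzero] at hs
      have h0 := hs.unique hasSum_zero
      rw [← h0]
      refine integral_congr_ae (Eventually.of_forall fun x => ?_)
      simp only [smul_eq_mul, hz]
      congr 2
      push_cast
      ring
    · simp_rw [hterm]
      exact ((hint _).const_mul _).aestronglyMeasurable
    · refine Eventually.of_forall fun x => ?_
      simp only [norm_mul, norm_div, norm_pow, Complex.norm_real, Real.norm_eq_abs,
        Complex.norm_natCast, le_refl]
    · exact Eventually.of_forall fun x => (hsumm x).summable
    · simp_rw [fun x => (hsumm x).tsum_eq]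
      -- Half of the Gaussian absorbs the exponential: e^{|z||x|} e^{-px²/2} ≤ e^{|z|²/p}
      -- e^{-px²/4}, by completing the square.
      refine Integrable.mono' (((hint (polyGaussian (p / 2) (by positivity) 1)).norm).const_mul
        (Real.exp (‖z‖ ^ 2 / p))) ?_ (Eventually.of_forall fun x => ?_)
      · exact (by fun_prop : Continuous fun x : ℝ =>
          Real.exp (‖z‖ * |x|)).aestronglyMeasurable.mul (hint _).norm.aestronglyMeasurable
      · rw [norm_mul, norm_norm, Real.norm_of_nonneg (Real.exp_pos _).le, norm_mul, norm_mul,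
          ← mul_assoc, ← mul_assoc]
        refine mul_le_mul_of_nonneg_right ?_ (norm_nonneg _)
        simp only [polyGaussian_apply, Polynomial.eval_one, one_mul, Complex.norm_real,
          Real.norm_of_nonneg (Real.exp_pos _).le]
        rw [← Real.exp_add, ← Real.exp_add]
        refine Real.exp_le_exp.2 ?_
        have h1 : ‖z‖ ^ 2 / p + -(p / 2 * x ^ 2 / 2) - (‖z‖ * |x| + -(p * x ^ 2 / 2))
            = (‖z‖ - p * |x| / 2) ^ 2 / p := by
          rw [← sq_abs x]
          field_simp
          ring
        have h2 : 0 ≤ (‖z‖ - p * |x| / 2) ^ 2 / p := by positivity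
        linarith
    · refine Eventually.of_forall fun x => ?_
      have := NormedSpace.expSeries_div_hasSum_exp (𝔸 := ℂ) (z * x)
      rw [← Complex.exp_eq_exp_ℂ] at this
      exact this.mul_right _
  rw [Lp.eq_zero_iff_ae_eq_zero]
  filter_upwards [hg] with x hx
  refine (mul_eq_zero.1 hx).resolve_left ?_
  rw [polyGaussian_apply, Polynomial.eval_one, one_mul]
  exact Complex.ofReal_ne_zero.2 (Real.exp_pos _).ne'

theorem inner_hermiteSchwartz {ω : ℝ} (hω : 0 < ω) (n : ℕ) (f : L2R) :
    inner ℂ ((hermiteSchwartz ω hω n).toLp 2 (volume : Measure ℝ)) f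
      = ∫ x, hermiteSchwartz ω hω n x * f x := by
  rw [L2.inner_def]
  refine integral_congr_ae ?_
  filter_upwards [(hermiteSchwartz ω hω n).coeFn_toLp 2 volume] with x hx
  rw [hx, RCLike.inner_apply, conj_hermiteSchwartz, mul_comm]

/-- The polynomials He_n(√(2ω) x) span all polynomials, so orthogonality to the Hermite functions
makes every moment against the Gaussian vanish. -/
theorem orthogonal_span_hermiteSchwartz {ω : ℝ} (hω : 0 < ω) :
    (Submodule.span ℂ (Set.range fun n =>
      (hermiteSchwartz ω hω n).toLp 2 (volume : Measure ℝ)))ᗮ = ⊥ := by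
  rw [eq_bot_iff]
  intro f hf
  rw [Submodule.mem_bot]
  have hint : ∀ φ : 𝓢(ℝ, ℂ), Integrable fun x => φ x * f x := fun φ =>
    (φ.memLp 2 volume).integrable_mul (Lp.memLp f)
  refine eq_zero_of_forall_integral_polyGaussian hω f fun P => ?_
  have hP : P ∈ Submodule.span ℝ (Set.range (hermitePoly ω)) := by
    rw [span_range_hermitePoly hω]
    exact Submodule.mem_top
  induction hP using Submodule.span_induction with
  | mem P hP =>
    obtain ⟨n, rfl⟩ := hP
    have h := Submodule.inner_right_of_mem_orthogonal (Submodule.subset_span (Set.mem_range_self n)) hf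
    rw [inner_hermiteSchwartz] at h
    simp_rw [hermiteSchwartz, smul_apply, smul_eq_mul, mul_assoc] at h
    rw [integral_const_mul] at h
    refine (mul_eq_zero.1 h).resolve_left (Complex.ofReal_ne_zero.2 (ne_of_gt ?_))
    have h1 := Real.pi_pos
    positivity
  | zero => simp [polyGaussian_apply]
  | add P Q _ _ hP hQ =>
    simp_rw [polyGaussian_add, add_apply, add_mul]
    rw [integral_add (hint _) (hint _), hP, hQ, add_zero]
  | smul a P _ hP =>
    simp_rw [polyGaussian_smul, smul_apply, smul_eq_mul, mul_assoc]
    rw [integral_const_mul, hP, mul_zero]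

/-- The Hilbert basis of `L²(ℝ)` that consists of the eigenfunctions of `ω x² - ω⁻¹ Δ`. -/
noncomputable def hermiteBasis (ω : ℝ) (hω : 0 < ω) : HilbertBasis ℕ ℂ L2R :=
  HilbertBasis.mkOfOrthogonalEqBot (orthonormal_hermiteSchwartz hω)
    (orthogonal_span_hermiteSchwartz hω)

theorem hermiteBasis_apply {ω : ℝ} (hω : 0 < ω) (n : ℕ) :
    hermiteBasis ω hω n = (hermiteSchwartz ω hω n).toLp 2 (volume : Measure ℝ) := by
  rw [hermiteBasis, HilbertBasis.coe_mkOfOrthogonalEqBot]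

/-! ### The harmonic oscillator -/

/-- The harmonic oscillator `a x² - b Δ` on Schwartz functions. -/
noncomputable def schwartzOscillator (a b : ℝ) (φ : 𝓢(ℝ, ℂ)) : 𝓢(ℝ, ℂ) :=
  (a : ℂ) • SchwartzMap.smulLeftCLM ℂ (fun x : ℝ => (x : ℂ) ^ 2) φ - (b : ℂ) • Δ φ

theorem schwartzOscillator_apply (a b : ℝ) (φ : 𝓢(ℝ, ℂ)) (x : ℝ) :
    schwartzOscillator a b φ x = a * ((x : ℂ) ^ 2 * φ x) - b * Δ φ x := by
  rw [schwartzOscillator, sub_apply, smul_apply, smul_apply,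
    SchwartzMap.smulLeftCLM_apply_apply (by fun_prop)]
  rfl

/-- Multiplication by x² and Δ act on distributions by acting on the test function, so the graph is
described by a weak identity. -/
theorem mem_graph_harmonicOscillator_iff (a b : ℝ) (f g : L2R) :
    (f, g) ∈ (harmonicOscillator a b).graph ↔
      ∀ φ : 𝓢(ℝ, ℂ), ∫ x, φ x * g x = ∫ x, schwartzOscillator a b φ x * f x := by
  have h : ∀ φ : 𝓢(ℝ, ℂ), ((a : ℂ) • TemperedDistribution.smulLeftCLM ℂ (fun x : ℝ => (x : ℂ) ^ 2)
      - (b : ℂ) • LineDeriv.laplacianCLM ℂ ℝ 𝓢'(ℝ, ℂ)) (f : 𝓢'(ℝ, ℂ)) φ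
      = (f : 𝓢'(ℝ, ℂ)) (schwartzOscillator a b φ) := by
    intro φ
    rw [schwartzOscillator, map_sub, map_smul, map_smul]
    change a • TemperedDistribution.smulLeftCLM ℂ (fun x : ℝ => (x : ℂ) ^ 2) (f : 𝓢'(ℝ, ℂ)) φ
      - b • LineDeriv.laplacianCLM ℂ ℝ 𝓢'(ℝ, ℂ) (f : 𝓢'(ℝ, ℂ)) φ = _
    rw [TemperedDistribution.laplacianCLM_apply, TemperedDistribution.laplacian_apply_apply,
      TemperedDistribution.smulLeftCLM_apply_apply]
    rfl
  rw [harmonicOscillator, mem_graph_maximalRealization]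
  constructor
  · intro hg φ
    have := DFunLike.congr_fun hg φ
    rw [h, Lp.toTemperedDistribution_apply, Lp.toTemperedDistribution_apply] at this
    exact this
  · intro hg
    ext φ
    rw [h, Lp.toTemperedDistribution_apply, Lp.toTemperedDistribution_apply]
    exact hg φ

theorem integral_schwartzOscillator_mul (a b : ℝ) (φ χ : 𝓢(ℝ, ℂ)) :
    ∫ x, schwartzOscillator a b φ x * χ x = ∫ x, φ x * schwartzOscillator a b χ x := by
  have h1 : ∀ φ χ : 𝓢(ℝ, ℂ), Integrable fun x : ℝ => φ x * χ x := fun φ χ =>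
    (φ.memLp 2 volume).integrable_mul (χ.memLp 2 volume)
  set X := (SchwartzMap.smulLeftCLM ℂ (fun x : ℝ => (x : ℂ) ^ 2) : 𝓢(ℝ, ℂ) →L[ℂ] 𝓢(ℝ, ℂ)) with hX
  have hXa : ∀ (φ : 𝓢(ℝ, ℂ)) (x : ℝ), X φ x = (x : ℂ) ^ 2 * φ x := fun φ x => by
    rw [hX, SchwartzMap.smulLeftCLM_apply_apply (by fun_prop)]
    rfl
  have hl : ∀ x, schwartzOscillator a b φ x * χ x = a * (X φ x * χ x) - b * (Δ φ x * χ x) :=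
    fun x => by
      rw [schwartzOscillator_apply, hXa]
      ring
  have hr : ∀ x, φ x * schwartzOscillator a b χ x = a * (φ x * X χ x) - b * (φ x * Δ χ x) :=
    fun x => by
      rw [schwartzOscillator_apply, hXa]
      ring
  simp_rw [hl, hr]
  rw [integral_sub ((h1 _ _).const_mul _) ((h1 _ _).const_mul _),
    integral_sub ((h1 _ _).const_mul _) ((h1 _ _).const_mul _), integral_const_mul,
    integral_const_mul, integral_const_mul, integral_const_mul,
    SchwartzMap.integral_mul_laplacian_right_eq_left]
  congr 2
  refine integral_congr_ae (Eventually.of_forall fun x => ?_)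
  simp only [hXa]
  ring

open Polynomial in
theorem laplacian_polyGaussian {p : ℝ} (hp : 0 < p) (P : ℝ[X]) (x : ℝ) :
    Δ (polyGaussian p hp P) x
      = polyGaussian p hp (derivative (derivative P - C p * X * P)
        - C p * X * (derivative P - C p * X * P)) x := by
  rw [SchwartzMap.laplacian_apply, InnerProductSpace.laplacian_eq_iteratedDeriv_real,
    iteratedDeriv_succ, iteratedDeriv_one, deriv_polyGaussian, deriv_polyGaussian]

-- Differentiate the raising relation and insert the lowering relation.
open Polynomial in
theorem hermitePoly_ode {ω : ℝ} (hω : 0 < ω) (n : ℕ) :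
    C (2 * ω) * X * derivative (hermitePoly ω n) - derivative (derivative (hermitePoly ω n))
      = C (2 * ω * n) * hermitePoly ω n := by
  have h := congrArg derivative (smul_hermitePoly_succ hω n)
  rw [derivative_smul, derivative_hermitePoly_succ, smul_smul, mul_left_comm,
    Real.mul_self_sqrt (by positivity), derivative_sub, derivative_mul, derivative_mul,
    derivative_C, derivative_X, smul_eq_C_mul] at h
  simp only [C_mul, map_natCast] at h ⊢
  push_cast at h
  linear_combination -h

/-- For H e^{-ωx²/2} the quadratic terms cancel, and ω⁻¹(2ωxH' − H'' + ωH) = (2n+1)H remains by the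
Hermite equation. -/
theorem schwartzOscillator_hermiteSchwartz {ω : ℝ} (hω : 0 < ω) (n : ℕ) (x : ℝ) :
    schwartzOscillator ω ω⁻¹ (hermiteSchwartz ω hω n) x
      = (2 * n + 1 : ℝ) * hermiteSchwartz ω hω n x := by
  have hΔ : Δ (hermiteSchwartz ω hω n) = ((√√ω / √(n.factorial * √Real.pi) : ℝ) : ℂ) •
      Δ (polyGaussian ω hω (hermitePoly ω n)) := by
    rw [hermiteSchwartz, ← SchwartzMap.laplacianCLM_eq ℂ, map_smul, SchwartzMap.laplacianCLM_eq]
  have hode := congrArg (Polynomial.eval x) (hermitePoly_ode hω n)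
  rw [schwartzOscillator_apply, hΔ, smul_apply, laplacian_polyGaussian, hermiteSchwartz, smul_apply]
  simp only [polyGaussian_apply, smul_eq_mul, Polynomial.derivative_sub, Polynomial.derivative_mul,
    Polynomial.derivative_C, Polynomial.derivative_X, Polynomial.eval_sub, Polynomial.eval_add,
    Polynomial.eval_mul, Polynomial.eval_C, Polynomial.eval_X, Polynomial.eval_zero,
    Polynomial.eval_one] at hode ⊢
  generalize √√ω / √(n.factorial * √Real.pi) = c
  generalize Real.exp (-(ω * x ^ 2 / 2)) = e
  norm_cast
  have hω' : ω ≠ 0 := hω.ne'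
  field_simp
  push_cast
  linear_combination (c * e) * hode

theorem integral_hermiteSchwartz_mul_schwartz {ω : ℝ} (hω : 0 < ω) (φ : 𝓢(ℝ, ℂ)) (n : ℕ) :
    ∫ x, schwartzOscillator ω ω⁻¹ φ x * hermiteSchwartz ω hω n x
      = (2 * n + 1 : ℝ) * ∫ x, φ x * hermiteSchwartz ω hω n x := by
  rw [integral_schwartzOscillator_mul, ← integral_const_mul]
  refine integral_congr_ae (Eventually.of_forall fun x => ?_)
  simp only [schwartzOscillator_hermiteSchwartz]
  ring

/-- Expansion of the pairing of a Schwartz function with an `L²` function in the Hermite basis. -/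
theorem hasSum_integral_mul {ω : ℝ} (hω : 0 < ω) (φ : 𝓢(ℝ, ℂ)) (f : L2R) :
    HasSum (fun n => (∫ x, φ x * hermiteSchwartz ω hω n x) * inner ℂ (hermiteBasis ω hω n) f)
      (∫ x, φ x * f x) := by
  -- The pairing is bilinear while the inner product conjugates its first argument; conjugating φ
  -- compensates.
  have h := (hermiteBasis ω hω).hasSum_inner_mul_inner (star (φ.toLp 2 (volume : Measure ℝ))) f
  have hstar : ∀ g : L2R, inner ℂ (star (φ.toLp 2 (volume : Measure ℝ))) g = ∫ x, φ x * g x := by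
    intro g
    rw [L2.inner_def]
    refine integral_congr_ae ?_
    filter_upwards [φ.coeFn_toLp 2 volume, Lp.coeFn_star (φ.toLp 2 (volume : Measure ℝ))]
      with x h1 h2
    rw [RCLike.inner_apply, h2, Pi.star_apply, h1, mul_comm]
    simp
  rw [hstar] at h
  have hcoef : ∀ n, inner ℂ (star (φ.toLp 2 (volume : Measure ℝ))) (hermiteBasis ω hω n)
      = ∫ x, φ x * hermiteSchwartz ω hω n x := fun n => by
    rw [hstar, hermiteBasis_apply]
    refine integral_congr_ae ?_
    filter_upwards [(hermiteSchwartz ω hω n).coeFn_toLp 2 volume] with x h1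
    rw [h1]
  simpa only [hcoef] using h

/-- The harmonic oscillator with maximal domain is diagonal in the Hermite basis. -/
theorem mem_graph_harmonicOscillator_iff_inner {ω : ℝ} (hω : 0 < ω) (f g : L2R) :
    (f, g) ∈ (harmonicOscillator ω ω⁻¹).graph ↔
      ∀ n, (inner ℂ (hermiteBasis ω hω n) g : ℂ)
        = (2 * n + 1 : ℝ) * inner ℂ (hermiteBasis ω hω n) f := by
  rw [mem_graph_harmonicOscillator_iff]
  constructor
  · intro h n
    -- The Hermite functions are themselves admissible test functions.
    rw [hermiteBasis_apply, inner_hermiteSchwartz, inner_hermiteSchwartz, h, ← integral_const_mul]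
    refine integral_congr_ae (Eventually.of_forall fun x => ?_)
    simp only [schwartzOscillator_hermiteSchwartz]
    ring
  · intro h φ
    -- Conversely, both pairings are expanded in the basis and agree term by term, so no separate
    -- core or closure argument is needed.
    refine (hasSum_integral_mul hω φ g).unique ?_
    convert hasSum_integral_mul hω (schwartzOscillator ω ω⁻¹ φ) f using 2 with n
    rw [h, integral_hermiteSchwartz_mul_schwartz]
    ring

/-! ### Eigenfunctions of the concentration operator -/

section

open Polynomial

variable {p : ℝ} {hp : 0 < p}

theorem fourier_polyGaussian_add (P Q : ℝ[X]) (η : ℝ) :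
    𝓕 (polyGaussian p hp (P + Q)) η = 𝓕 (polyGaussian p hp P) η + 𝓕 (polyGaussian p hp Q) η := by
  rw [polyGaussian_add, FourierTransform.fourier_add, add_apply]

theorem fourier_polyGaussian_smul (a : ℝ) (P : ℝ[X]) (η : ℝ) :
    𝓕 (polyGaussian p hp (a • P)) η = (a : ℂ) * 𝓕 (polyGaussian p hp P) η := by
  rw [polyGaussian_smul, FourierTransform.fourier_smul, smul_apply, smul_eq_mul]

theorem fourier_polyGaussian_derivative (P : ℝ[X]) (η : ℝ) :
    𝓕 (polyGaussian p hp (derivative P - C p * X * P)) η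
      = 2 * Real.pi * Complex.I * η * 𝓕 (polyGaussian p hp P) η := by
  have h := Real.fourier_deriv (polyGaussian p hp P).integrable
    (polyGaussian p hp P).differentiable
    (by rw [deriv_polyGaussian]; exact SchwartzMap.integrable _)
  rw [deriv_polyGaussian] at h
  exact congrFun h η

theorem hasDerivAt_fourier_polyGaussian (P : ℝ[X]) (η : ℝ) :
    HasDerivAt (𝓕 (polyGaussian p hp P) : 𝓢(ℝ, ℂ))
      (-(2 * Real.pi * Complex.I) * 𝓕 (polyGaussian p hp (X * P)) η) η := by
  have hX : ∀ x : ℝ, polyGaussian p hp (X * P) x = (x : ℂ) * polyGaussian p hp P x := fun x => by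
    simp only [polyGaussian_apply, eval_mul, eval_X]
    push_cast
    ring
  have hint : Integrable fun x : ℝ => x • polyGaussian p hp P x := by
    refine (polyGaussian p hp (X * P)).integrable.congr (Eventually.of_forall fun x => ?_)
    simp only [hX, Complex.real_smul]
  have h := Real.hasDerivAt_fourier (polyGaussian p hp P).integrable hint η
  have hfun : (fun x : ℝ => (-2 * Real.pi * Complex.I * x) • polyGaussian p hp P x)
      = ((-(2 * Real.pi * Complex.I)) • polyGaussian p hp (X * P) : 𝓢(ℝ, ℂ)) := by
    ext x
    rw [smul_apply, hX, smul_eq_mul, smul_eq_mul]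
    ring
  rw [hfun, ← SchwartzMap.fourier_coe, ← SchwartzMap.fourier_coe,
    FourierTransform.fourier_smul] at h
  exact h

/-- The raising relation is split so that H_n' − pXH_n, which represents a derivative, is
transformed into multiplication by 2πiη. For p = ω ± α the remaining coefficient 2ω − p is ω ∓ α. -/
theorem fourier_polyGaussian_hermitePoly_succ {ω : ℝ} (hω : 0 < ω) (n : ℕ) (η : ℝ) :
    (√(2 * ω) : ℂ) * 𝓕 (polyGaussian p hp (hermitePoly ω (n + 1))) η
      = ((2 * ω - p : ℝ) : ℂ) * 𝓕 (polyGaussian p hp (X * hermitePoly ω n)) η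
        - 2 * Real.pi * Complex.I * η * 𝓕 (polyGaussian p hp (hermitePoly ω n)) η := by
  have h : √(2 * ω) • hermitePoly ω (n + 1) = (2 * ω - p) • (X * hermitePoly ω n)
      + (-1 : ℝ) • (derivative (hermitePoly ω n) - C p * X * hermitePoly ω n) := by
    rw [smul_hermitePoly_succ hω, smul_eq_C_mul, smul_eq_C_mul, C_sub, C_neg, C_1]
    ring
  rw [← fourier_polyGaussian_smul, h, fourier_polyGaussian_add, fourier_polyGaussian_smul,
    fourier_polyGaussian_smul, fourier_polyGaussian_derivative]
  push_cast
  ring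

theorem fourier_polyGaussian_one (η : ℝ) :
    𝓕 (polyGaussian p hp 1) η
      = (((√(p / (2 * Real.pi)))⁻¹ * Real.exp (-(2 * Real.pi ^ 2 * η ^ 2 / p)) : ℝ) : ℂ) := by
  have hb : 0 < ((p / (2 * Real.pi) : ℝ) : ℂ).re := by
    rw [Complex.ofReal_re]
    positivity
  have hfun : (polyGaussian p hp 1 : ℝ → ℂ)
      = fun x : ℝ => Complex.exp (-Real.pi * ((p / (2 * Real.pi) : ℝ) : ℂ) * (x : ℂ) ^ 2) := by
    ext x
    rw [polyGaussian_apply, eval_one, one_mul, Complex.ofReal_exp]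
    congr 1
    have := Complex.ofReal_ne_zero.2 Real.pi_ne_zero
    push_cast
    field_simp
  rw [SchwartzMap.fourier_coe, hfun, fourier_gaussian_pi hb]
  have hsq : ((p / (2 * Real.pi) : ℝ) : ℂ) ^ (1 / 2 : ℂ) = ((√(p / (2 * Real.pi)) : ℝ) : ℂ) := by
    rw [Real.sqrt_eq_rpow, Complex.ofReal_cpow (by positivity)]
    norm_num
  simp only
  rw [hsq, one_div, Complex.ofReal_mul, Complex.ofReal_inv, Complex.ofReal_exp]
  congr 2
  have := Complex.ofReal_ne_zero.2 Real.pi_ne_zero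
  have := Complex.ofReal_ne_zero.2 hp.ne'
  push_cast
  field_simp

/-- The heat operator maps `He_n(√(2ω) x) exp (-(ω+α) x² / 2)` to a multiple of
`He_n(√(2ω) x) exp (-(ω-α) x² / 2)`; this is the statement on the Fourier side. -/
theorem exp_mul_fourier_polyGaussian {α β ω : ℝ} (hω : 0 < ω) (h₁ : 0 < ω + α) (h₂ : 0 < ω - α)
    (h : β * (ω ^ 2 - α ^ 2) = α) (n : ℕ) (η : ℝ) :
    ((Real.exp (-(β * (2 * Real.pi * η) ^ 2)) : ℝ) : ℂ)
        * 𝓕 (polyGaussian (ω + α) h₁ (hermitePoly ω n)) η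
      = ((((ω - α) / (ω + α)) ^ n * √((ω - α) / (ω + α)) : ℝ) : ℂ)
        * 𝓕 (polyGaussian (ω - α) h₂ (hermitePoly ω n)) η := by
  have hq : (ω - α) / (ω + α) = 1 - 2 * β * (ω - α) := by
    rw [div_eq_iff h₁.ne']
    linear_combination 2 * h
  induction n generalizing η with
  | zero =>
    rw [hermitePoly_zero, fourier_polyGaussian_one, fourier_polyGaussian_one, pow_zero, one_mul,
      ← Complex.ofReal_mul, ← Complex.ofReal_mul]
    congr 1
    rw [mul_left_comm, ← Real.exp_add, ← mul_assoc]
    congr 1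
    · rw [Real.sqrt_div h₁.le, Real.sqrt_div h₂.le, Real.sqrt_div h₂.le]
      have := Real.sqrt_pos.2 h₁
      have := Real.sqrt_pos.2 h₂
      have := Real.sqrt_pos.2 Real.two_pi_pos
      field_simp
    -- Comparing exponents requires 1/(ω−α) − 1/(ω+α) = 2β, which is `h`.
    · congr 1
      have h3 := h₁.ne'
      have h4 := h₂.ne'
      field_simp
      linear_combination (-2 * η ^ 2) * h
  | succ n ih =>
    set c : ℝ := ((ω - α) / (ω + α)) ^ n * √((ω - α) / (ω + α)) with hc
    set E : ℝ → ℂ := fun η => ((Real.exp (-(β * (2 * Real.pi * η) ^ 2)) : ℝ) : ℂ) with hE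
    have hEd : HasDerivAt E (-(8 * Real.pi ^ 2 * β * η) * E η) η := by
      have h1 : HasDerivAt (fun η : ℝ => -(β * (2 * Real.pi * η) ^ 2))
          (-(8 * Real.pi ^ 2 * β * η)) η := by
        have h2 := (((((hasDerivAt_id η).const_mul (2 * Real.pi)).pow 2).const_mul β)).neg
        refine h2.congr_deriv ?_
        simp
        ring
      refine h1.exp.ofReal_comp.congr_deriv ?_
      rw [hE]
      push_cast
      ring
    -- Differentiating the induction hypothesis in η brings in the transforms of X·H_n, which the
    -- raising relation needs.
    have hl := hEd.mul (hasDerivAt_fourier_polyGaussian (hp := h₁) (hermitePoly ω n) η)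
    have hr := (hasDerivAt_fourier_polyGaussian (hp := h₂) (hermitePoly ω n) η).const_mul (c : ℂ)
    have hfun : (E * 𝓕 (polyGaussian (ω + α) h₁ (hermitePoly ω n)) : ℝ → ℂ)
        = fun η => (c : ℂ) * 𝓕 (polyGaussian (ω - α) h₂ (hermitePoly ω n)) η := funext ih
    rw [hfun] at hl
    have hd := hl.unique hr
    have h0 := ih η
    change E η * _ = _ at h0
    change E η * _ = _
    have h5 := fourier_polyGaussian_hermitePoly_succ (hp := h₁) hω n η
    have h6 := fourier_polyGaussian_hermitePoly_succ (hp := h₂) hω n η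
    have hs : (√(2 * ω) : ℂ) ≠ 0 :=
      Complex.ofReal_ne_zero.2 (Real.sqrt_pos.2 (by positivity)).ne'
    apply mul_left_cancel₀ hs
    rw [pow_succ, mul_right_comm, ← hc, Complex.ofReal_mul, mul_left_comm, h5, mul_left_comm, h6]
    generalize 𝓕 (polyGaussian (ω + α) h₁ (hermitePoly ω n)) η = A at *
    generalize 𝓕 (polyGaussian (ω - α) h₂ (hermitePoly ω n)) η = B at *
    generalize 𝓕 (polyGaussian (ω + α) h₁ (X * hermitePoly ω n)) η = A' at *
    generalize 𝓕 (polyGaussian (ω - α) h₂ (X * hermitePoly ω n)) η = B' at *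
    have hpi : (2 * Real.pi * Complex.I : ℂ) ≠ 0 := Complex.two_pi_I_ne_zero
    have hA' : E η * A' = c * B' + 4 * Real.pi * Complex.I * β * η * (c * B) := by
      apply mul_left_cancel₀ hpi
      linear_combination (-1) * hd - (8 * Real.pi ^ 2 * β * η) * h0
        - (8 * Real.pi ^ 2 * β * η * (c * B)) * Complex.I_sq
    have hqc : (((ω - α) / (ω + α) : ℝ) : ℂ) * (ω + α) = ω - α := by
      rw [← Complex.ofReal_add, ← Complex.ofReal_mul, div_mul_cancel₀ _ h₁.ne']
      push_cast
      rfl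
    have hq' : (((ω - α) / (ω + α) : ℝ) : ℂ) = 1 - 2 * β * (ω - α) := by
      rw [hq]
      push_cast
      rfl
    generalize ((((ω - α) / (ω + α) : ℝ)) : ℂ) = q at *
    push_cast
    -- The B' terms match by q(ω+α) = ω−α, and the ηB terms by q = 1 − 2β(ω−α).
    linear_combination ((ω : ℂ) - α) * hA' - 2 * Real.pi * Complex.I * η * h0
      - c * B' * hqc + c * 2 * Real.pi * Complex.I * η * B * hq'

end

/-- The Hermite functions are eigenfunctions of the concentration operator. -/
theorem concentrationOp_hermiteBasis {α β ω : ℝ} (hω : 0 < ω) (h₁ : 0 < ω + α) (h₂ : 0 < ω - α)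
    (h : β * (ω ^ 2 - α ^ 2) = α) {mS mF : Lp ℂ ∞ (volume : Measure ℝ)}
    (hS : mS =ᵐ[volume] fun x : ℝ => ((Real.exp (-(α / 2) * x ^ 2) : ℝ) : ℂ))
    (hF : mF =ᵐ[volume] fun ξ : ℝ => ((Real.exp (-(β / 2) * ξ ^ 2) : ℝ) : ℂ)) (n : ℕ) :
    concentrationOp mS mF (hermiteBasis ω hω n)
      = ((((ω - α) / (ω + α)) ^ n * √((ω - α) / (ω + α)) : ℝ) : ℂ) • hermiteBasis ω hω n := by
  set u := polyGaussian (ω + α) h₁ (hermitePoly ω n) with hu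
  set v := polyGaussian (ω - α) h₂ (hermitePoly ω n) with hv
  set w := polyGaussian ω hω (hermitePoly ω n) with hw
  set l : ℂ := ((((ω - α) / (ω + α)) ^ n * √((ω - α) / (ω + α)) : ℝ) : ℂ) with hl
  have hSw : spaceFilter mS (w.toLp 2 volume) = u.toLp 2 volume := by
    apply Lp.ext
    filter_upwards [coeFn_spaceFilter mS (w.toLp 2 volume), hS, w.coeFn_toLp 2 volume,
      u.coeFn_toLp 2 volume] with x h1 h2 h3 h4
    rw [h1, h2, h3, h4, hw, hu, polyGaussian_apply, polyGaussian_apply, ← Complex.ofReal_mul,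
      mul_left_comm, ← Real.exp_add]
    congr 3
    ring
  have hSv : spaceFilter mS (v.toLp 2 volume) = w.toLp 2 volume := by
    apply Lp.ext
    filter_upwards [coeFn_spaceFilter mS (v.toLp 2 volume), hS, w.coeFn_toLp 2 volume,
      v.coeFn_toLp 2 volume] with x h1 h2 h3 h4
    rw [h1, h2, h3, h4, hw, hv, polyGaussian_apply, polyGaussian_apply, ← Complex.ofReal_mul,
      mul_left_comm, ← Real.exp_add]
    congr 3
    ring
  have hFu : fourierFilter mF (fourierFilter mF (u.toLp 2 volume)) = l • v.toLp 2 volume := by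
    apply (FourierTransform.fourierEquiv ℂ L2R).injective
    rw [FourierTransform.fourierEquiv_apply, FourierTransform.fourierEquiv_apply,
      FourierTransform.fourier_smul]
    apply Lp.ext
    have h5 := fourier_fourierFilter_gaussian hF (u.toLp 2 volume)
    rw [SchwartzMap.toLp_fourier_eq] at h5
    rw [SchwartzMap.toLp_fourier_eq]
    filter_upwards [h5, Lp.coeFn_smul l ((𝓕 v).toLp 2 (volume : Measure ℝ)),
      (𝓕 v).coeFn_toLp 2 volume, (𝓕 u).coeFn_toLp 2 volume] with η h1 h2 h3 h4
    rw [h1, h2, Pi.smul_apply, h3, h4, smul_eq_mul]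
    exact exp_mul_fourier_polyGaussian hω h₁ h₂ h n η
  have hb : hermiteBasis ω hω n
      = ((√√ω / √(n.factorial * √Real.pi) : ℝ) : ℂ) • w.toLp 2 volume := by
    rw [hermiteBasis_apply, hermiteSchwartz]
    exact map_smul (SchwartzMap.toLpCLM ℂ ℂ 2 (volume : Measure ℝ)) _ _
  rw [concentrationOp_eq hS hF, hb, map_smul, smul_comm]
  congr 1
  change spaceFilter mS (fourierFilter mF (fourierFilter mF (spaceFilter mS _))) = _
  rw [hSw, hFu, map_smul, hSv]

/-! ### The parameters -/

/-- Since e^{-arsinh √s} = √(1+s) − √s is the reciprocal of √(1+s) + √s, its square is their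
quotient. -/
theorem exp_neg_two_mul_arsinh_sqrt {s : ℝ} (hs : 0 < s) :
    Real.exp (-(2 * Real.arsinh √s)) = (√(1 + s) - √s) / (√(1 + s) + √s) := by
  have h1 : Real.exp (-Real.arsinh √s) = √(1 + s) - √s := by
    rw [← Real.arsinh_neg, Real.exp_arsinh, neg_sq, Real.sq_sqrt hs.le]
    ring
  have h2 : (√(1 + s) - √s) * (√(1 + s) + √s) = 1 := by
    have h3 := Real.mul_self_sqrt hs.le
    have h4 := Real.mul_self_sqrt (by positivity : 0 ≤ 1 + s)
    linear_combination h4 - h3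
  have h5 : 0 < √(1 + s) + √s := by positivity
  rw [eq_div_iff h5.ne', two_mul, neg_add, Real.exp_add, h1, mul_assoc, h2, mul_one]

theorem concentrationOp_adjoint (mS mF : Lp ℂ ∞ (volume : Measure ℝ)) :
    (concentrationOp mS mF).adjoint = concentrationOp mS mF := by
  simp only [concentrationOp, ContinuousLinearMap.adjoint_comp,
    ContinuousLinearMap.adjoint_adjoint, ContinuousLinearMap.comp_assoc]

/-- The eigenpairs of an operator that is diagonal in a Hilbert basis with distinct eigenvalues. -/
theorem HilbertBasis.eigenpair_iff {H : Type*} [NormedAddCommGroup H] [InnerProductSpace ℂ H]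
    (b : HilbertBasis ℕ ℂ H) {T : H →L[ℂ] H} {l : ℕ → ℂ} (hl : Function.Injective l)
    (hTb : ∀ n, T (b n) = l n • b n)
    (hT : ∀ f n, (inner ℂ (b n) (T f) : ℂ) = l n * inner ℂ (b n) f) (z : ℂ) (f : H) :
    (f ≠ 0 ∧ T f = z • f) ↔ ∃ n, z = l n ∧ ∃ c : ℂ, c ≠ 0 ∧ f = c • b n := by
  constructor
  · rintro ⟨hf, hz⟩
    -- A nonzero coefficient determines z, so injectivity of l leaves only one nonzero coefficient.
    have hcoef : ∀ n, inner ℂ (b n) f ≠ (0 : ℂ) → z = l n := fun n hn => by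
      have h := hT f n
      rw [hz, inner_smul_right] at h
      exact mul_right_cancel₀ hn h
    obtain ⟨n, hn⟩ : ∃ n, inner ℂ (b n) f ≠ (0 : ℂ) := by
      by_contra! h0
      apply hf
      have := b.hasSum_repr f
      simp only [b.repr_apply_apply, h0, zero_smul] at this
      exact this.unique hasSum_zero
    refine ⟨n, hcoef n hn, inner ℂ (b n) f, hn, ?_⟩
    have h0 : ∀ k, k ≠ n → b.repr f k • b k = 0 := fun k hk => by
      rw [b.repr_apply_apply]
      by_contra hne
      exact hk (hl ((hcoef k (left_ne_zero_of_smul hne)).symm.trans (hcoef n hn)))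
    rw [← b.repr_apply_apply]
    exact (b.hasSum_repr f).unique (hasSum_single n h0)
  · rintro ⟨n, rfl, c, hc, rfl⟩
    refine ⟨smul_ne_zero hc (b.orthonormal.ne_zero n), ?_⟩
    rw [map_smul, hTb, smul_comm]

theorem mainTheorem4 (α β : ℝ) (hα : 0 < α) (hβ : 0 < β)
    (mS mF : Lp ℂ ∞ (volume : Measure ℝ))
    (hS : mS =ᵐ[volume] fun x : ℝ => ((Real.exp (-(α / 2) * x ^ 2) : ℝ) : ℂ))
    (hF : mF =ᵐ[volume] fun ξ : ℝ => ((Real.exp (-(β / 2) * ξ ^ 2) : ℝ) : ℂ)) :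
    (∃ E : L2R →L[ℂ] L2R, IsOperatorExp ((β : ℂ) • laplacianL2) E ∧
      concentrationOp mS mF = spaceFilter mS ∘L E ∘L spaceFilter mS) ∧
    IsOperatorExp
      (-((Real.arsinh (Real.sqrt (α * β)) : ℂ) •
        harmonicOscillator (Real.sqrt (α * (1 + α * β) / β))
          (Real.sqrt (β / (α * (1 + α * β))))))
      (concentrationOp mS mF) ∧
    ∃ ψ : ℕ → L2R,
      (∀ n, ψ n =ᵐ[volume] fun x : ℝ =>
        (((α * (1 + α * β) / β) ^ (1 / 8 : ℝ) *
          hermiteFunction n ((α * (1 + α * β) / β) ^ (1 / 4 : ℝ) * x) : ℝ) : ℂ)) ∧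
      Orthonormal ℂ ψ ∧
      (Submodule.span ℂ (Set.range ψ)).topologicalClosure = ⊤ ∧
      ∀ (l : ℂ) (f : L2R),
        (f ≠ 0 ∧ concentrationOp mS mF f = l • f) ↔
          ∃ n : ℕ, l = (Real.exp (-Real.arsinh (Real.sqrt (α * β)) * (2 * n + 1)) : ℝ) ∧
            ∃ c : ℂ, c ≠ 0 ∧ f = c • ψ n := by
  have hαβ : 0 < α * β := mul_pos hα hβ
  set γ : ℝ := α * (1 + α * β) / β with hγ
  have hγ0 : 0 < γ := by positivity
  set ω : ℝ := √γ with hω_def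
  set τ : ℝ := Real.arsinh √(α * β) with hτ
  have hω : 0 < ω := Real.sqrt_pos.2 hγ0
  have hω2 : ω ^ 2 = γ := Real.sq_sqrt hγ0.le
  have hωinv : √(β / (α * (1 + α * β))) = ω⁻¹ := by
    rw [hω_def, ← Real.sqrt_inv, hγ, inv_div]
  have hpar : β * (ω ^ 2 - α ^ 2) = α := by
    rw [hω2, hγ]
    field_simp
    ring
  have hτ0 : 0 < τ := Real.arsinh_pos_iff.2 (Real.sqrt_pos.2 hαβ)
  have hρ : 0 < √(α / β) := Real.sqrt_pos.2 (by positivity)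
  -- With the common factor √(α/β) taken out of ω and α, the quotient (ω−α)/(ω+α) becomes the arsinh
  -- expression with s = αβ.
  have hω' : ω = √(α / β) * √(1 + α * β) := by
    rw [hω_def, hγ, ← Real.sqrt_mul (by positivity)]
    congr 1
    ring
  have hα' : α = √(α / β) * √(α * β) := by
    rw [← Real.sqrt_mul (by positivity), show α / β * (α * β) = α ^ 2 by field_simp,
      Real.sqrt_sq hα.le]
  have hlt : √(α * β) < √(1 + α * β) := Real.sqrt_lt_sqrt hαβ.le (by linarith)
  have h₁ : 0 < ω + α := by positivity
  have h₂ : 0 < ω - α := by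
    have : ω - α = √(α / β) * (√(1 + α * β) - √(α * β)) := by
      linear_combination hω' - hα'
    rw [this]
    exact mul_pos hρ (sub_pos.2 hlt)
  have hq : (ω - α) / (ω + α) = Real.exp (-(2 * τ)) := by
    rw [hτ, exp_neg_two_mul_arsinh_sqrt hαβ,
      show ω - α = √(α / β) * (√(1 + α * β) - √(α * β)) by linear_combination hω' - hα',
      show ω + α = √(α / β) * (√(1 + α * β) + √(α * β)) by linear_combination hω' + hα',
      mul_div_mul_left _ _ hρ.ne']
  have hl : ∀ n : ℕ, ((ω - α) / (ω + α)) ^ n * √((ω - α) / (ω + α))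
      = Real.exp (-(τ * (2 * n + 1))) := fun n => by
    rw [hq, ← Real.exp_half, ← Real.exp_nat_mul, ← Real.exp_add]
    congr 1
    ring
  have hKb : ∀ n : ℕ, concentrationOp mS mF (hermiteBasis ω hω n)
      = ((Real.exp (-(τ * (2 * n + 1))) : ℝ) : ℂ) • hermiteBasis ω hω n := fun n => by
    rw [concentrationOp_hermiteBasis hω h₁ h₂ hpar hS hF, hl]
  have hK : ∀ (f : L2R) (n : ℕ), (inner ℂ (hermiteBasis ω hω n) (concentrationOp mS mF f) : ℂ)
      = ((Real.exp (-(τ * (2 * n + 1))) : ℝ) : ℂ) * inner ℂ (hermiteBasis ω hω n) f := by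
    intro f n
    -- Self-adjointness moves the operator onto the basis vector, so the eigenvector equations give
    -- all coefficients.
    rw [← ContinuousLinearMap.adjoint_inner_left, concentrationOp_adjoint, hKb, inner_smul_left,
      Complex.conj_ofReal]
  refine ⟨⟨_, isOperatorExp_laplacianL2 hβ hF, concentrationOp_eq hS hF⟩, ?_,
    hermiteBasis ω hω, fun n => ?_, (hermiteBasis ω hω).orthonormal,
    (hermiteBasis ω hω).dense_span, fun l f => ?_⟩
  · rw [hωinv]
    refine (hermiteBasis ω hω).isOperatorExp_of_diagonal (m := fun n => τ * (2 * n + 1))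
      (fun n => by positivity) (fun f g => ?_) hK
    have hτc : (τ : ℂ) ≠ 0 := Complex.ofReal_ne_zero.2 hτ0.ne'
    simp only [mem_graph_neg_iff, mem_graph_smul_iff, mem_graph_harmonicOscillator_iff_inner hω]
    constructor
    · rintro ⟨_, ⟨g', hg', rfl⟩, rfl⟩ n
      rw [inner_neg_right, inner_smul_right, hg']
      push_cast
      ring
    · intro h
      refine ⟨-g, ⟨-((τ : ℂ)⁻¹ • g), fun n => ?_, ?_⟩, (neg_neg g).symm⟩
      · rw [inner_neg_right, inner_smul_right, h]
        push_cast
        field_simp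
      · rw [smul_neg, smul_inv_smul₀ hτc]
  · rw [hermiteBasis_apply]
    filter_upwards [(hermiteSchwartz ω hω n).coeFn_toLp 2 volume] with x hx
    have h4 : γ ^ (1 / 4 : ℝ) = √ω := by
      rw [hω_def, Real.sqrt_eq_rpow, Real.sqrt_eq_rpow, ← Real.rpow_mul hγ0.le]
      norm_num
    have h8 : γ ^ (1 / 8 : ℝ) = √√ω := by
      rw [← h4, Real.sqrt_eq_rpow, ← Real.rpow_mul hγ0.le]
      norm_num
    rw [hx, hermiteSchwartz_apply, h4, h8]
  · rw [(hermiteBasis ω hω).eigenpair_iff (fun m n hmn => ?_) hKb hK l f]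
    · simp only [neg_mul]
    -- The eigenvalues are distinct because τ > 0.
    · have h := Real.exp_injective (Complex.ofReal_injective hmn)
      have h' := mul_left_cancel₀ hτ0.ne' (neg_injective h)
      exact_mod_cast (by linarith : (m : ℝ) = n)
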